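/- **Setting.** Let $(\Omega,\mathscr F,P)$ be a probability space with a filtration $(\mathscr F_t)_{t\ge 0}$ satisfying the usual conditions (right-continuous, $\mathscr F_0$ contains all $P$-null sets), and let $\mathscr T$ be the set of stopping times with values in $[0,\infty]$. For each firm $i\in\{1,2\}$ let $\pi^{0i},\pi^{Li},\pi^{Fi},\pi^{Bi}$ be real, product-measurable, $P\otimes dt$-integrable processes whose integrals $\int_0^t\cdot\,ds$ are adapted (the revenue of firm $i$ when, respectively, no firm, only firm $i$, only its opponent, or both firms have invested), such that, $P\otimes dt$-a.e., $\pi^{Li}\ge\pi^{Bi}$ and $\pi^{0i}\ge\pi^{Fi}$ for $i=1,2$, $\pi^{B2}-\pi^{F2}\le\pi^{B1}-\pi^{F1}$ and $\pi^{L2}-\pi^{F2}\le\pi^{L1}-\pi^{F1}$. (In)equalities between random variables are meant a.s. For $\tau\in\mathscr T$ and $j\ne i$ define $$F^i_\tau=\int_0^\tau\pi^{0i}_s\,ds+\operatorname*{ess\,sup}_{\tau'\ge\tau}E\Bigl[\int_\tau^{\tau'}\pi^{Fi}_s\,ds+\int_{\tau'}^\infty\pi^{Bi}_s\,ds\Bigm|\mathscr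 F_\tau\Bigr],$$ let $\tau_F^i(\tau)$ be the latest stopping time $\tau'\ge\tau$ attaining this essential supremum (it exists and is a.s. unique), and let $$L^i_\tau=\int_0^\tau\pi^{0i}_s\,ds+E\Bigl[\int_\tau^{\tau_F^j(\tau)}\pi^{Li}_s\,ds+\int_{\tau_F^j(\tau)}^\infty\pi^{Bi}_s\,ds\Bigm|\mathscr F_\tau\Bigr],\qquad M^i_\tau=\int_0^\tau\pi^{0i}_s\,ds+E\Bigl[\int_\tau^\infty\pi^{Bi}_s\,ds\Bigm|\mathscr F_\tau\Bigr].$$ For $\vartheta\in\mathscr T$, plans $\tau^1,\tau^2\in\mathscr T$ with $\tau^1,\tau^2\ge\vartheta$ are an *equilibrium of the subgame beginning at $\vartheta$* if no firm $i$ can increase $$E\bigl[L^i_{\tau^i}1_{\{\tau^i<\tau^j\}}+F^i_{\tau^j}1_{\{\tau^i>\tau^j\}}+M^i_{\tau^i}1_{\{\tau^i=\tau^j\}}\bigm|\mathscr F_\vartheta\bigr]$$ with positive probability by replacing $\tau^i$ with another stopping time $\tau\ge\vartheta$. For a plan $\tau_*^j\in\mathscr T$ of firm $j$ and $\vartheta'\in\mathscr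 T$, firm $i$'s *deviation problem* is $$\operatorname*{ess\,sup}_{\tau\in[\vartheta',\,\tau_*^j\vee\vartheta']}E\Bigl[\int_0^\tau\pi^{0i}_s\,ds+\int_\tau^\infty\pi^{Li}_s\,ds\Bigm|\mathscr F_{\vartheta'}\Bigr].\tag{D}$$ **Corollary 1.** Let $\vartheta\in\mathscr T$ and let $\tau_S\in\mathscr T$ solve $$\operatorname*{ess\,sup}_{\tau\in[\vartheta,\,\tau_F^2(\vartheta)]}E\bigl[L^1_\tau\bigm|\mathscr F_\vartheta\bigr].$$ 1. Suppose that for each stopping time $\vartheta'\ge\vartheta$ there is a solution $\tau_D^2(\vartheta')\in\mathscr T$ of (D) for $i=2$, $\tau_*^1=\tau_S$ such that on $\{\vartheta'<\tau_S\}$ either $\tau_D^2(\vartheta')\ge\tau_F^1(\vartheta')$ or $L^2_{\tau_D^2(\vartheta')}\le E\bigl[F^2_{\tau_S}\bigm|\mathscr F_{\tau_D^2(\vartheta')}\bigr]$. Then it is an equilibrium of the subgame beginning at $\vartheta$ that firm $1$ plans to invest at $\tau_S$ and firm $2$ at $\tau_F^2(\vartheta)$. 2. If $\pi^{L1}-\pi^{01}\ge\pi^{L2}-\pi^{02}$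 ($P\otimes dt$-a.e.), then for each stopping time $\vartheta'\ge\vartheta$, $\tau_S$ attains (D) for $i=2$, $\tau_*^1=\tau_S$ on the event $\{\vartheta'\le\tau_S\}$, and $\tau_S\vee\vartheta'$ solves (D) on all of $\Omega$. -/

import Mathlib

open MeasureTheory
open scoped NNReal

namespace InvestmentTiming

noncomputable section

/-- The two firms. -/
inductive Firm where
  | one : Firm
  | two : Firm

/-- The opponent of a firm. -/
def Firm.other : Firm → Firm
  | .one => .two
  | .two => .one

/-- Lebesgue measure `dt` on the time axis `[0, ∞)`. -/
def timeMeasure : Measure ℝ≥0 := Measure.comap ((↑) : ℝ≥0 → ℝ) volume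

theorem timeMeasure_apply (s : Set ℝ≥0) :
    timeMeasure s = volume (((↑) : ℝ≥0 → ℝ) '' s) :=
  (MeasurableEmbedding.subtype_coe measurableSet_Ici).comap_apply volume s

theorem timeMeasure_Iic (t : ℝ≥0) : timeMeasure (Set.Iic t) = t := by
  have : ((↑) : ℝ≥0 → ℝ) '' Set.Iic t = Set.Icc 0 (t : ℝ) := by
    ext x
    constructor
    · rintro ⟨y, hy, rfl⟩
      exact ⟨y.2, hy⟩
    · rintro ⟨h0, h1⟩
      exact ⟨⟨x, h0⟩, h1, rfl⟩
  rw [timeMeasure_apply, this, Real.volume_Icc, sub_zero, ENNReal.ofReal_coe_nnreal]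

/-- `dt` is σ-finite, so that the product measure `P ⊗ dt` is the usual one. -/
instance sigmaFinite_timeMeasure : SigmaFinite timeMeasure := by
  refine ⟨⟨⟨fun n => Set.Iic n, fun _ => trivial, fun n => ?_, ?_⟩⟩⟩
  · rw [timeMeasure_Iic]
    exact ENNReal.coe_lt_top
  · refine Set.eq_univ_of_forall fun x => ?_
    obtain ⟨n, hn⟩ := exists_nat_ge x
    exact Set.mem_iUnion.2 ⟨n, hn⟩

/-! ### Information and stopping times -/

/-- The usual conditions: the filtration is right-continuous, and `𝓕 0` contains every
`P`-null set (in particular the probability space is complete). -/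
structure UsualConditions {Ω : Type*} {m : MeasurableSpace Ω} (P : Measure Ω)
    (𝓕 : Filtration ℝ≥0 m) : Prop where
  rightContinuous : 𝓕.IsRightContinuous
  complete : ∀ s : Set Ω, P s = 0 → MeasurableSet[𝓕 0] s

/-- The set `𝒯` of all stopping times with values in `[0, ∞]`. -/
abbrev StopTime {Ω : Type*} {m : MeasurableSpace Ω} (𝓕 : Filtration ℝ≥0 m) : Type _ :=
  {τ : Ω → WithTop ℝ≥0 // IsStoppingTime 𝓕 τ}

/-- The σ-algebra `𝓕_τ` of the events known at a stopping time. -/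
abbrev StopTime.past {Ω : Type*} {m : MeasurableSpace Ω} {𝓕 : Filtration ℝ≥0 m}
    (τ : StopTime 𝓕) : MeasurableSpace Ω :=
  τ.2.measurableSpace

/-- The stopping time `τ ∨ σ`. -/
def StopTime.max {Ω : Type*} {m : MeasurableSpace Ω} {𝓕 : Filtration ℝ≥0 m}
    (τ σ : StopTime 𝓕) : StopTime 𝓕 :=
  ⟨fun ω => Max.max (τ.1 ω) (σ.1 ω), τ.2.max σ.2⟩

/-- `ALE P τ σ`: the stopping times satisfy `τ ≤ σ` almost surely. -/
def ALE {Ω : Type*} {m : MeasurableSpace Ω} {𝓕 : Filtration ℝ≥0 m} (P : Measure Ω)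
    (τ σ : StopTime 𝓕) : Prop :=
  ∀ᵐ ω ∂P, τ.1 ω ≤ σ.1 ω

/-! ### Essential suprema of families of random variables -/

/-- `g` is an essential supremum of the family `S`: a random variable that dominates every
member of `S` a.s. and is a.s. at most any other such random variable. -/
def IsFamilyEssSup {Ω : Type*} {m : MeasurableSpace Ω} (P : Measure Ω) (S : Set (Ω → ℝ))
    (g : Ω → ℝ) : Prop :=
  AEMeasurable g P ∧ (∀ f ∈ S, f ≤ᵐ[P] g) ∧
    ∀ h : Ω → ℝ, AEMeasurable h P → (∀ f ∈ S, f ≤ᵐ[P] h) → g ≤ᵐ[P] h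

open Classical in
/-- The (a.s. unique) essential supremum of a family of random variables. -/
def familyEssSup {Ω : Type*} {m : MeasurableSpace Ω} (P : Measure Ω) (S : Set (Ω → ℝ)) :
    Ω → ℝ :=
  if h : ∃ g, IsFamilyEssSup P S g then h.choose else 0

/-- `σ` attains `esssup_{τ ∈ A} V τ` (equivalently, solves this problem): `σ` is admissible,
and no admissible `τ` gives a larger value with positive probability. -/
def Attains {Ω : Type*} {m : MeasurableSpace Ω} {𝓕 : Filtration ℝ≥0 m} (P : Measure Ω)
    (A : Set (StopTime 𝓕)) (V : StopTime 𝓕 → Ω → ℝ) (σ : StopTime 𝓕) : Prop :=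
  σ ∈ A ∧ ∀ τ ∈ A, V τ ≤ᵐ[P] V σ

/-! ### Revenue streams -/

/-- The requirements on each revenue process: product measurability, `P ⊗ dt`-integrability,
and adaptedness of the accrued revenue `∫_0^t X_s ds`. -/
structure IsRevenue {Ω : Type*} {m : MeasurableSpace Ω} (P : Measure Ω)
    (𝓕 : Filtration ℝ≥0 m) (X : ℝ≥0 → Ω → ℝ) : Prop where
  measurable : Measurable (fun p : Ω × ℝ≥0 => X p.2 p.1)
  integrable : Integrable (fun p : Ω × ℝ≥0 => X p.2 p.1) (P.prod timeMeasure)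
  adapted : ∀ t : ℝ≥0, Measurable[𝓕 t] (fun ω => ∫ s in Set.Iic t, X s ω ∂timeMeasure)

/-- The revenue accrued in `(σ, ρ]`, that is `∫_σ^ρ X_s ds` (used for `σ ≤ ρ` a.s. only). -/
def accrued {Ω : Type*} (X : ℝ≥0 → Ω → ℝ) (σ ρ : Ω → WithTop ℝ≥0) (ω : Ω) : ℝ :=
  ∫ s in {s : ℝ≥0 | σ ω < (s : WithTop ℝ≥0) ∧ (s : WithTop ℝ≥0) ≤ ρ ω}, X s ω ∂timeMeasure

/-- `∫_0^τ X_s ds`. -/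
def accruedUntil {Ω : Type*} (X : ℝ≥0 → Ω → ℝ) (τ : Ω → WithTop ℝ≥0) : Ω → ℝ :=
  accrued X (fun _ => 0) τ

/-- `∫_τ^∞ X_s ds`. -/
def accruedFrom {Ω : Type*} (X : ℝ≥0 → Ω → ℝ) (τ : Ω → WithTop ℝ≥0) : Ω → ℝ :=
  accrued X τ (fun _ => ⊤)

/-- The primitives of the duopoly: for each firm `i` the revenue process while nobody has
invested (`π0 i`), as sole investor (`πL i`), as laggard (`πF i`) and after both investments
(`πB i`), together with the standing orders, each understood `P ⊗ dt`-a.e. -/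
structure Duopoly {Ω : Type*} {m : MeasurableSpace Ω} (P : Measure Ω)
    (𝓕 : Filtration ℝ≥0 m) where
  π0 : Firm → ℝ≥0 → Ω → ℝ
  πL : Firm → ℝ≥0 → Ω → ℝ
  πF : Firm → ℝ≥0 → Ω → ℝ
  πB : Firm → ℝ≥0 → Ω → ℝ
  revenue_π0 : ∀ i, IsRevenue P 𝓕 (π0 i)
  revenue_πL : ∀ i, IsRevenue P 𝓕 (πL i)
  revenue_πF : ∀ i, IsRevenue P 𝓕 (πF i)
  revenue_πB : ∀ i, IsRevenue P 𝓕 (πB i)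
  /-- the laggard's investment harms the first investor -/
  πB_le_πL : ∀ i, ∀ᵐ p ∂(P.prod timeMeasure), πB i p.2 p.1 ≤ πL i p.2 p.1
  /-- the first investment harms the laggard -/
  πF_le_π0 : ∀ i, ∀ᵐ p ∂(P.prod timeMeasure), πF i p.2 p.1 ≤ π0 i p.2 p.1
  /-- firm 2 gains less than firm 1 from investing as laggard -/
  gainB_le : ∀ᵐ p ∂(P.prod timeMeasure),
    πB .two p.2 p.1 - πF .two p.2 p.1 ≤ πB .one p.2 p.1 - πF .one p.2 p.1
  /-- firm 2 gains less than firm 1 from being leader instead of laggard -/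
  gainL_le : ∀ᵐ p ∂(P.prod timeMeasure),
    πL .two p.2 p.1 - πF .two p.2 p.1 ≤ πL .one p.2 p.1 - πF .one p.2 p.1

namespace Duopoly

/-! ### Follower, leader and simultaneous payoffs -/

/-- `E[∫_τ^τ' πF_s ds + ∫_τ'^∞ πB_s ds | 𝓕_τ]`: what firm `i` expects from `τ` on if the
opponent invests at `τ` and firm `i` follows at `τ'`. -/
def followValue {Ω : Type*} {m : MeasurableSpace Ω} {P : Measure Ω} {𝓕 : Filtration ℝ≥0 m}
    (D : Duopoly P 𝓕) (i : Firm) (τ τ' : StopTime 𝓕) : Ω → ℝ :=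
  P[fun ω => accrued (D.πF i) τ.1 τ'.1 ω + accruedFrom (D.πB i) τ'.1 ω | τ.past]

/-- The follower payoff `F^i(τ)`. -/
def follower {Ω : Type*} {m : MeasurableSpace Ω} {P : Measure Ω} {𝓕 : Filtration ℝ≥0 m}
    (D : Duopoly P 𝓕) (i : Firm) (τ : StopTime 𝓕) : Ω → ℝ := fun ω =>
  accruedUntil (D.π0 i) τ.1 ω +
    familyEssSup P {f | ∃ τ' : StopTime 𝓕, ALE P τ τ' ∧ f = D.followValue i τ τ'} ω

/-- `σ` is the latest stopping time attaining the value `F^i(τ)`. -/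
def IsFollowerTime {Ω : Type*} {m : MeasurableSpace Ω} {P : Measure Ω}
    {𝓕 : Filtration ℝ≥0 m} (D : Duopoly P 𝓕) (i : Firm) (τ σ : StopTime 𝓕) : Prop :=
  Attains P {τ' | ALE P τ τ'} (D.followValue i τ) σ ∧
    ∀ σ', Attains P {τ' | ALE P τ τ'} (D.followValue i τ) σ' → ALE P σ' σ

open Classical in
/-- The follower reaction time `τ_F^i(τ)`: the (a.s. unique) latest stopping time attaining
`F^i(τ)`. The default value `τ` is never used under the usual conditions. -/
def followerTime {Ω : Type*} {m : MeasurableSpace Ω} {P : Measure Ω}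
    {𝓕 : Filtration ℝ≥0 m} (D : Duopoly P 𝓕) (i : Firm) (τ : StopTime 𝓕) : StopTime 𝓕 :=
  if h : ∃ σ, D.IsFollowerTime i τ σ then h.choose else τ

/-- The leader payoff `L^i(τ)`: the opponent follows at its reaction time. -/
def leader {Ω : Type*} {m : MeasurableSpace Ω} {P : Measure Ω} {𝓕 : Filtration ℝ≥0 m}
    (D : Duopoly P 𝓕) (i : Firm) (τ : StopTime 𝓕) : Ω → ℝ := fun ω =>
  accruedUntil (D.π0 i) τ.1 ω +
    (P[fun ω' => accrued (D.πL i) τ.1 (D.followerTime i.other τ).1 ω' +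
      accruedFrom (D.πB i) (D.followerTime i.other τ).1 ω' | τ.past]) ω

/-- The payoff `M^i(τ)` from simultaneous investment. -/
def simultaneous {Ω : Type*} {m : MeasurableSpace Ω} {P : Measure Ω} {𝓕 : Filtration ℝ≥0 m}
    (D : Duopoly P 𝓕) (i : Firm) (τ : StopTime 𝓕) : Ω → ℝ := fun ω =>
  accruedUntil (D.π0 i) τ.1 ω + (P[accruedFrom (D.πB i) τ.1 | τ.past]) ω

/-! ### The timing game -/

/-- Firm `i`'s conditional expected payoff at `ϑ` if it plans to invest at `τi` and its
opponent at `τj`. -/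
def payoff {Ω : Type*} {m : MeasurableSpace Ω} {P : Measure Ω} {𝓕 : Filtration ℝ≥0 m}
    (D : Duopoly P 𝓕) (i : Firm) (ϑ τi τj : StopTime 𝓕) : Ω → ℝ :=
  P[fun ω => {ω | τi.1 ω < τj.1 ω}.indicator (D.leader i τi) ω +
      {ω | τj.1 ω < τi.1 ω}.indicator (D.follower i τj) ω +
      {ω | τi.1 ω = τj.1 ω}.indicator (D.simultaneous i τi) ω | ϑ.past]

/-- The plan `τi` is a best reply of firm `i` to the plan `τj` in the subgame at `ϑ`. -/
def IsBestReply {Ω : Type*} {m : MeasurableSpace Ω} {P : Measure Ω} {𝓕 : Filtration ℝ≥0 m}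
    (D : Duopoly P 𝓕) (i : Firm) (ϑ τi τj : StopTime 𝓕) : Prop :=
  Attains P {τ | ALE P ϑ τ} (fun τ => D.payoff i ϑ τ τj) τi

/-- The plans `τ1` of firm 1 and `τ2` of firm 2 are an equilibrium of the subgame at `ϑ`. -/
def IsEquilibrium {Ω : Type*} {m : MeasurableSpace Ω} {P : Measure Ω} {𝓕 : Filtration ℝ≥0 m}
    (D : Duopoly P 𝓕) (ϑ τ1 τ2 : StopTime 𝓕) : Prop :=
  D.IsBestReply .one ϑ τ1 τ2 ∧ D.IsBestReply .two ϑ τ2 τ1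

/-! ### The optimization problems -/

/-- `τS` solves firm 1's leader problem constrained by `τ_F^2(ϑ)`:
`esssup_{τ ∈ [ϑ, τ_F^2(ϑ)]} E[L^1_τ | 𝓕_ϑ]`. -/
def SolvesLeaderProblem {Ω : Type*} {m : MeasurableSpace Ω} {P : Measure Ω}
    {𝓕 : Filtration ℝ≥0 m} (D : Duopoly P 𝓕) (ϑ τS : StopTime 𝓕) : Prop :=
  Attains P {τ | ALE P ϑ τ ∧ ALE P τ (D.followerTime .two ϑ)}
    (fun τ => P[D.leader .one τ | ϑ.past]) τS

/-- `E[∫_0^τ π0_s ds + ∫_τ^∞ πL_s ds | 𝓕_ϑ']`: the value at `ϑ'` of investing at `τ` as a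
permanent monopolist. -/
def monopolyValue {Ω : Type*} {m : MeasurableSpace Ω} {P : Measure Ω} {𝓕 : Filtration ℝ≥0 m}
    (D : Duopoly P 𝓕) (i : Firm) (ϑ' τ : StopTime 𝓕) : Ω → ℝ :=
  P[fun ω => accruedUntil (D.π0 i) τ.1 ω + accruedFrom (D.πL i) τ.1 ω | ϑ'.past]

/-- The admissible times `[ϑ', τj ∨ ϑ']` in the deviation problem at `ϑ'` against the
opponent's plan `τj`. -/
def deviationTimes {Ω : Type*} {m : MeasurableSpace Ω} {𝓕 : Filtration ℝ≥0 m}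
    (P : Measure Ω) (τj ϑ' : StopTime 𝓕) : Set (StopTime 𝓕) :=
  {τ | ALE P ϑ' τ ∧ ALE P τ (τj.max ϑ')}

/-- `τD` solves firm `i`'s deviation problem at `ϑ'` against the opponent's plan `τj`:
`esssup_{τ ∈ [ϑ', τj ∨ ϑ']} E[∫_0^τ π0_s ds + ∫_τ^∞ πL_s ds | 𝓕_ϑ']`. -/
def SolvesDeviationProblem {Ω : Type*} {m : MeasurableSpace Ω} {P : Measure Ω}
    {𝓕 : Filtration ℝ≥0 m} (D : Duopoly P 𝓕) (i : Firm) (τj ϑ' τD : StopTime 𝓕) : Prop :=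
  Attains P (deviationTimes P τj ϑ') (D.monopolyValue i ϑ') τD

/-- The no-deviation condition for firm `i` in the subgame at `ϑ` against the opponent's plan
`τj`: for each stopping time `ϑ' ≥ ϑ` there is a solution `τD` of the deviation problem at `ϑ'`
such that on `{ϑ' < τj}` either `τD ≥ τ_F^j(ϑ')` or `L^i_{τD} ≤ E[F^i_{τj} | 𝓕_{τD}]`. -/
def NoDeviation {Ω : Type*} {m : MeasurableSpace Ω} {P : Measure Ω} {𝓕 : Filtration ℝ≥0 m}
    (D : Duopoly P 𝓕) (i : Firm) (ϑ τj : StopTime 𝓕) : Prop :=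
  ∀ ϑ' : StopTime 𝓕, ALE P ϑ ϑ' →
    ∃ τD : StopTime 𝓕, D.SolvesDeviationProblem i τj ϑ' τD ∧
      ∀ᵐ ω ∂P, ϑ'.1 ω < τj.1 ω →
        (D.followerTime i.other ϑ').1 ω ≤ τD.1 ω ∨
          D.leader i τD ω ≤ (P[D.follower i τj | τD.past]) ω

end Duopoly

end

end InvestmentTiming

namespace InvestmentTiming

open Filter Topology

noncomputable section

/-! Write `T = τ_F^2(ϑ)`. Every optimization here amounts to maximizing `E[∫_0^τ X ds]` plus a term
independent of `τ`, with `X = π^F - π^B` for a follower and `X = π^0 - π^L` for a leader or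
monopolist. Such a functional is modular for `∨` and `∧`, continuous along pointwise limits and
bounded. Hence latest maximizers exist (`IsModular.exists_latest_max`), and ordering two integrands
orders their maximizers. Pasting makes unconditional and conditional optimality equivalent.

Reactions are time-consistent: the reaction to any `τ` in `[ϑ, T]` is still `T`
(`followerTime_consistent`). Firm 1 reacts no later than firm 2, so it follows an investment at `T`
at once. Thus every plan `τ` of firm 1 against `T` yields `E[L^1_{τ ∧ T} | 𝓕_ϑ]`, and `τS` is a best
reply.

Firm 2's equilibrium payoff is that of following `τS` at `T`. Investing at or after `τS` yields no
more. A preemptive plan is compared with a solution `δ` of the deviation problem: where firm 1 would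
react by `δ`, simultaneous investment at `δ` is the bound and is itself no better than following
`τS`; elsewhere the no-deviation inequality applies (`setIntegral_leadPath_two_le`).

For the second claim, `τS` maximizes firm 1's delay gain on `[ϑ, T]`. Modularity extends this to the
deviation problem, and the order of the delay gains transfers it to firm 2. -/

/-- The revenue `∫_0^t X_s ds` accrued until a deterministic time `t ∈ [0, ∞]`. -/
def cum {Ω : Type*} (X : ℝ≥0 → Ω → ℝ) (t : WithTop ℝ≥0) (ω : Ω) : ℝ :=
  ∫ s in {s : ℝ≥0 | 0 < (s : WithTop ℝ≥0) ∧ (s : WithTop ℝ≥0) ≤ t}, X s ω ∂timeMeasure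

/-- `P ⊗ dt`-integrability of a process. -/
def ProdIntegrable {Ω : Type*} {m : MeasurableSpace Ω} (P : Measure Ω) (X : ℝ≥0 → Ω → ℝ) : Prop :=
  Integrable (fun p : Ω × ℝ≥0 => X p.2 p.1) (P.prod timeMeasure)

instance nullSingletonClass_timeMeasure : NullSingletonClass timeMeasure :=
  ⟨fun x => by rw [timeMeasure_apply]; simp⟩

theorem measurableSet_accrual (a b : WithTop ℝ≥0) :
    MeasurableSet {s : ℝ≥0 | a < (s : WithTop ℝ≥0) ∧ (s : WithTop ℝ≥0) ≤ b} :=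
  (measurableSet_lt measurable_const WithTop.measurable_coe).inter
    (measurableSet_le WithTop.measurable_coe measurable_const)

/-! ### Pathwise integrals of revenue streams. -/

section
variable {Ω : Type*} {m : MeasurableSpace Ω} {P : Measure Ω} {X X' : ℝ≥0 → Ω → ℝ}

theorem accruedUntil_apply (X : ℝ≥0 → Ω → ℝ) (τ : Ω → WithTop ℝ≥0) (ω : Ω) :
    accruedUntil X τ ω = cum X (τ ω) ω := rfl

theorem accrued_eq {σ ρ : Ω → WithTop ℝ≥0} {ω : Ω}
    (hX : Integrable (fun s => X s ω) timeMeasure) (h : σ ω ≤ ρ ω) :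
    accrued X σ ρ ω = cum X (ρ ω) ω - cum X (σ ω) ω := by
  have : {s : ℝ≥0 | 0 < (s : WithTop ℝ≥0) ∧ (s : WithTop ℝ≥0) ≤ ρ ω} =
      {s : ℝ≥0 | 0 < (s : WithTop ℝ≥0) ∧ (s : WithTop ℝ≥0) ≤ σ ω} ∪
        {s : ℝ≥0 | σ ω < (s : WithTop ℝ≥0) ∧ (s : WithTop ℝ≥0) ≤ ρ ω} := by
    ext s
    simp only [Set.mem_ofPred_eq, Set.mem_union]
    constructor
    · rintro ⟨h1, h2⟩
      rcases le_or_gt (s : WithTop ℝ≥0) (σ ω) with h3 | h3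
      · exact Or.inl ⟨h1, h3⟩
      · exact Or.inr ⟨h3, h2⟩
    · rintro (⟨h1, h2⟩ | ⟨h1, h2⟩)
      · exact ⟨h1, h2.trans h⟩
      · exact ⟨lt_of_le_of_lt bot_le h1, h2⟩
  unfold accrued cum
  rw [this, setIntegral_union _ (measurableSet_accrual _ _) hX.integrableOn hX.integrableOn]
  · ring
  · rw [Set.disjoint_left]
    rintro s ⟨-, h1⟩ ⟨h2, -⟩
    exact absurd h1 (not_le.2 h2)

theorem accruedFrom_eq {σ : Ω → WithTop ℝ≥0} {ω : Ω}
    (hX : Integrable (fun s => X s ω) timeMeasure) :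
    accruedFrom X σ ω = cum X ⊤ ω - cum X (σ ω) ω :=
  accrued_eq hX le_top

theorem ProdIntegrable.ae_integrable [SFinite P] (hX : ProdIntegrable P X) :
    ∀ᵐ ω ∂P, Integrable (fun s => X s ω) timeMeasure :=
  Integrable.prod_right_ae hX

theorem ProdIntegrable.sub (hX : ProdIntegrable P X) (hX' : ProdIntegrable P X') :
    ProdIntegrable P (fun s ω => X s ω - X' s ω) :=
  Integrable.sub hX hX'

theorem ProdIntegrable.integrable_cum (hX : ProdIntegrable P X) {τ : Ω → WithTop ℝ≥0}
    (hτ : Measurable τ) : Integrable (fun ω => cum X (τ ω) ω) P := by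
  have hS : MeasurableSet {p : Ω × ℝ≥0 | 0 < (p.2 : WithTop ℝ≥0) ∧ (p.2 : WithTop ℝ≥0) ≤ τ p.1} :=
    (measurableSet_lt measurable_const (WithTop.measurable_coe.comp measurable_snd)).inter
      (measurableSet_le (WithTop.measurable_coe.comp measurable_snd) (hτ.comp measurable_fst))
  have := (Integrable.indicator hX hS).integral_prod_left
  refine this.congr (Eventually.of_forall fun ω => ?_)
  simp only [cum]
  rw [← integral_indicator (measurableSet_accrual _ _)]
  rfl

theorem cum_sub {ω : Ω} {t : WithTop ℝ≥0} (hX : Integrable (fun s => X s ω) timeMeasure)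
    (hX' : Integrable (fun s => X' s ω) timeMeasure) :
    cum (fun s ω => X s ω - X' s ω) t ω = cum X t ω - cum X' t ω :=
  integral_sub hX.integrableOn hX'.integrableOn

/-- One null set serves all pairs `a ≤ b`, so the bound can be used at random times. -/
theorem cum_sub_cum_le [SFinite P] (hX : ProdIntegrable P X) (hX' : ProdIntegrable P X')
    (h : ∀ᵐ p ∂(P.prod timeMeasure), X p.2 p.1 ≤ X' p.2 p.1) :
    ∀ᵐ ω ∂P, ∀ a b : WithTop ℝ≥0, a ≤ b → cum X b ω - cum X a ω ≤ cum X' b ω - cum X' a ω := by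
  filter_upwards [hX.ae_integrable, hX'.ae_integrable, Measure.ae_ae_of_ae_prod h]
    with ω h1 h2 h3 a b hab
  rw [← accrued_eq (σ := fun _ => a) (ρ := fun _ => b) h1 hab,
    ← accrued_eq (σ := fun _ => a) (ρ := fun _ => b) h2 hab]
  exact integral_mono_ae h1.integrableOn h2.integrableOn (ae_restrict_of_ae h3)

theorem tendsto_cum {ω : Ω} (hX : Integrable (fun s => X s ω) timeMeasure)
    {t : ℕ → WithTop ℝ≥0} {a : WithTop ℝ≥0} (ht : Tendsto t atTop (𝓝 a)) :
    Tendsto (fun n => cum X (t n) ω) atTop (𝓝 (cum X a ω)) := by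
  unfold cum
  simp_rw [← integral_indicator (measurableSet_accrual _ _)]
  refine tendsto_integral_of_dominated_convergence (fun s => ‖X s ω‖)
    (fun n => (hX.indicator (measurableSet_accrual _ _)).aestronglyMeasurable) hX.norm
    (fun n => Eventually.of_forall fun s => norm_indicator_le_norm_self _ _) ?_
  -- Only at `s = a` can the indicators of `(0, t n]` fail to converge, and `dt` has no atoms.
  have hne : ∀ᵐ s : ℝ≥0 ∂timeMeasure, (s : WithTop ℝ≥0) ≠ a := by
    induction a with
    | top => exact Eventually.of_forall fun s => WithTop.coe_ne_top
    | coe a =>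
      have : ∀ᵐ s ∂timeMeasure, s ≠ a := by
        rw [ae_iff]; simp
      filter_upwards [this] with s hs
      exact fun h => hs (WithTop.coe_injective h)
  filter_upwards [hne] with s hs
  refine tendsto_const_nhds.congr' ?_
  rcases lt_or_gt_of_ne hs with h | h
  · filter_upwards [ht.eventually_const_lt h] with n hn
    refine Set.indicator_eq_indicator ?_ rfl
    exact and_congr_right fun _ => ⟨fun _ => hn.le, fun _ => h.le⟩
  · filter_upwards [ht.eventually_lt_const h] with n hn
    refine Set.indicator_eq_indicator ?_ rfl
    exact and_congr_right fun _ => ⟨fun h' => absurd h' (not_le.2 h), fun h' => absurd h' (not_le.2 hn)⟩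

theorem norm_cum_le {ω : Ω} (hX : Integrable (fun s => X s ω) timeMeasure) (t : WithTop ℝ≥0) :
    ‖cum X t ω‖ ≤ ∫ s, ‖X s ω‖ ∂timeMeasure :=
  (norm_integral_le_integral_norm _).trans
    (setIntegral_le_integral hX.norm (Eventually.of_forall fun _ => norm_nonneg _))

end

/-! ### Stopping times: order, pasting and limits. -/

section
variable {Ω : Type*} {m : MeasurableSpace Ω} {𝓕 : Filtration ℝ≥0 m} {P : Measure Ω}

/-- The stopping time `τ ∧ σ`. -/
def StopTime.min (τ σ : StopTime 𝓕) : StopTime 𝓕 :=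
  ⟨fun ω => Min.min (τ.1 ω) (σ.1 ω), τ.2.min σ.2⟩

theorem StopTime.max_apply (τ σ : StopTime 𝓕) (ω : Ω) :
    (τ.max σ).1 ω = Max.max (τ.1 ω) (σ.1 ω) := rfl

theorem StopTime.min_apply (τ σ : StopTime 𝓕) (ω : Ω) :
    (τ.min σ).1 ω = Min.min (τ.1 ω) (σ.1 ω) := rfl

theorem StopTime.measurable (τ : StopTime 𝓕) : Measurable τ.1 := τ.2.measurable'

theorem StopTime.past_le (τ : StopTime 𝓕) : τ.past ≤ m := τ.2.measurableSpace_le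

theorem ALE.refl (τ : StopTime 𝓕) : ALE P τ τ := Eventually.of_forall fun _ => le_rfl

theorem ALE.trans {τ σ ρ : StopTime 𝓕} (h : ALE P τ σ) (h' : ALE P σ ρ) : ALE P τ ρ := by
  filter_upwards [h, h'] with ω h1 h2 using h1.trans h2

theorem ALE.min {τ σ ρ : StopTime 𝓕} (h : ALE P ρ τ) (h' : ALE P ρ σ) :
    ALE P ρ (τ.min σ) := by
  filter_upwards [h, h'] with ω h1 h2 using le_min h1 h2

theorem ale_max_left (τ σ : StopTime 𝓕) : ALE P τ (τ.max σ) :=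
  Eventually.of_forall fun _ => le_max_left _ _

theorem ale_max_right (τ σ : StopTime 𝓕) : ALE P σ (τ.max σ) :=
  Eventually.of_forall fun _ => le_max_right _ _

theorem ale_min_right (τ σ : StopTime 𝓕) : ALE P (τ.min σ) σ :=
  Eventually.of_forall fun _ => min_le_right _ _

/-- Completeness puts every null set in `𝓕 0`. This is what lets almost sure order of stopping times
behave like pointwise order, as in `past_mono`. -/
theorem UsualConditions.measurableSet_congr (h𝓕 : UsualConditions P 𝓕) {t : ℝ≥0} {A B : Set Ω}
    (hA : MeasurableSet[𝓕 t] A) (h : ∀ᵐ ω ∂P, ω ∈ A ↔ ω ∈ B) : MeasurableSet[𝓕 t] B := by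
  have h0 : ∀ N : Set Ω, N ⊆ {ω | ¬(ω ∈ A ↔ ω ∈ B)} → MeasurableSet[𝓕 t] N := fun N hN =>
    𝓕.mono zero_le _ (h𝓕.complete N (measure_mono_null hN (ae_iff.1 h)))
  have : B = (A \ (A \ B)) ∪ (B \ A) := by
    ext ω
    simp only [Set.mem_union, Set.mem_sdiff]
    tauto
  rw [this]
  refine (hA.diff (h0 _ ?_)).union (h0 _ ?_)
  · rintro ω ⟨h1, h2⟩ h3
    exact h2 (h3.1 h1)
  · rintro ω ⟨h1, h2⟩ h3
    exact h2 (h3.2 h1)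

theorem UsualConditions.past_mono (h𝓕 : UsualConditions P 𝓕) {τ σ : StopTime 𝓕}
    (h : ALE P τ σ) : τ.past ≤ σ.past := by
  intro s hs
  refine ⟨hs.1, fun i => ?_⟩
  refine h𝓕.measurableSet_congr ((hs.2 i).inter (σ.2 i)) ?_
  filter_upwards [h] with ω hω
  simp only [Set.mem_inter_iff, Set.mem_ofPred_eq]
  exact ⟨fun h => ⟨h.1.1, h.2⟩, fun h => ⟨⟨h.1, hω.trans h.2⟩, h.2⟩⟩

open Classical in
/-- The stopping time that equals `σ` on the event `C` and `ρ` off it. -/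
def StopTime.paste (C : Set Ω) (σ ρ : StopTime 𝓕) (hσ : MeasurableSet[σ.past] C)
    (hρ : MeasurableSet[ρ.past] C) : StopTime 𝓕 :=
  ⟨fun ω => if ω ∈ C then σ.1 ω else ρ.1 ω, fun i => by
    have : {ω | (if ω ∈ C then σ.1 ω else ρ.1 ω) ≤ (i : WithTop ℝ≥0)} =
        (C ∩ {ω | σ.1 ω ≤ i}) ∪ (Cᶜ ∩ {ω | ρ.1 ω ≤ i}) := by
      ext ω
      by_cases h : ω ∈ C <;> simp [h]
    rw [this]
    exact (hσ.2 i).union ((MeasurableSet.compl hρ).2 i)⟩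

theorem StopTime.paste_of_mem {C : Set Ω} {σ ρ : StopTime 𝓕} {hσ : MeasurableSet[σ.past] C}
    {hρ : MeasurableSet[ρ.past] C} {ω : Ω} (h : ω ∈ C) : (paste C σ ρ hσ hρ).1 ω = σ.1 ω :=
  if_pos h

theorem StopTime.paste_of_notMem {C : Set Ω} {σ ρ : StopTime 𝓕} {hσ : MeasurableSet[σ.past] C}
    {hρ : MeasurableSet[ρ.past] C} {ω : Ω} (h : ω ∉ C) : (paste C σ ρ hσ hρ).1 ω = ρ.1 ω :=
  if_neg h

/-- The pointwise supremum of a sequence of stopping times. -/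
def StopTime.iSup (σ : ℕ → StopTime 𝓕) : StopTime 𝓕 :=
  ⟨fun ω => ⨆ n, (σ n).1 ω, fun i => by
    have : {ω | (⨆ n, (σ n).1 ω) ≤ (i : WithTop ℝ≥0)} = ⋂ n, {ω | (σ n).1 ω ≤ i} := by
      ext ω
      rw [Set.mem_iInter]
      exact iSup_le_iff (α := WithTop ℝ≥0)
    rw [this]
    exact MeasurableSet.iInter fun n => (σ n).2 i⟩

/-- The pointwise infimum of a sequence of stopping times of a right-continuous filtration. -/
def StopTime.iInf (h : 𝓕.IsRightContinuous) (σ : ℕ → StopTime 𝓕) : StopTime 𝓕 :=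
  ⟨fun ω => ⨅ n, (σ n).1 ω, IsStoppingTime.iInf fun n => (σ n).2⟩

/-! ### Maximizers of modular functionals. -/

/-- A real functional on stopping times that is modular for `∨` and `∧`, continuous along
pointwise limits, and bounded above. -/
structure IsModular (J : StopTime 𝓕 → ℝ) : Prop where
  modular : ∀ σ ρ, J (σ.max ρ) + J (σ.min ρ) = J σ + J ρ
  tendsto : ∀ (s : ℕ → StopTime 𝓕) (σ : StopTime 𝓕),
    (∀ ω, Tendsto (fun n => (s n).1 ω) atTop (𝓝 (σ.1 ω))) → Tendsto (fun n => J (s n)) atTop (𝓝 (J σ))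
  bounded : ∃ B, ∀ σ, J σ ≤ B

/-- A family of stopping times that is a lattice and closed under pointwise limits. -/
structure IsClosedLattice (S : Set (StopTime 𝓕)) : Prop where
  max : ∀ σ ∈ S, ∀ ρ ∈ S, σ.max ρ ∈ S
  min : ∀ σ ∈ S, ∀ ρ ∈ S, σ.min ρ ∈ S
  lim : ∀ (s : ℕ → StopTime 𝓕) (σ : StopTime 𝓕), (∀ n, s n ∈ S) →
    (∀ ω, Tendsto (fun n => (s n).1 ω) atTop (𝓝 (σ.1 ω))) → σ ∈ S

/-- The maximum of the first `k + 1` members of a sequence of stopping times. -/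
def StopTime.runMax (σ : ℕ → StopTime 𝓕) : ℕ → StopTime 𝓕
  | 0 => σ 0
  | k + 1 => (runMax σ k).max (σ (k + 1))

theorem StopTime.le_runMax (σ : ℕ → StopTime 𝓕) (ω : Ω) {j k : ℕ} (h : j ≤ k) :
    (σ j).1 ω ≤ (runMax σ k).1 ω := by
  induction k with
  | zero => rw [Nat.le_zero.1 h]; exact le_rfl
  | succ k ih =>
    rcases h.lt_or_eq with h | rfl
    · exact (ih (Nat.lt_succ_iff.1 h)).trans (le_max_left _ _)
    · exact le_max_right _ _

theorem StopTime.runMax_le (σ : ℕ → StopTime 𝓕) (ω : Ω) (k : ℕ) {a : WithTop ℝ≥0}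
    (h : ∀ j, (σ j).1 ω ≤ a) : (runMax σ k).1 ω ≤ a := by
  induction k with
  | zero => exact h 0
  | succ k ih => exact max_le ih (h _)

theorem StopTime.tendsto_runMax (σ : ℕ → StopTime 𝓕) (ω : Ω) :
    Tendsto (fun k => (runMax σ k).1 ω) atTop (𝓝 ((StopTime.iSup σ).1 ω)) := by
  have hm : Monotone fun k => (runMax σ k).1 ω :=
    monotone_nat_of_le_succ fun k => le_max_left _ _
  have he : (StopTime.iSup σ).1 ω = ⨆ k, (runMax σ k).1 ω :=
    le_antisymm (iSup_le fun n => (le_runMax σ ω le_rfl).trans (le_iSup (fun k => (runMax σ k).1 ω) n))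
      (iSup_le fun k => runMax_le σ ω k fun j => le_iSup (fun n => (σ n).1 ω) j)
  rw [he]
  exact tendsto_atTop_iSup hm

/-- A bounded continuous modular functional attains its maximum on a closed lattice: the upper
limit of a sufficiently fast maximizing sequence is a maximizer. -/
theorem IsModular.exists_max (h𝓕 : 𝓕.IsRightContinuous) {J : StopTime 𝓕 → ℝ} (hJ : IsModular J)
    {S : Set (StopTime 𝓕)} (hS : IsClosedLattice S) (hne : S.Nonempty) :
    ∃ σ ∈ S, ∀ ρ ∈ S, J ρ ≤ J σ := by
  obtain ⟨B, hB⟩ := hJ.bounded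
  have hbdd : BddAbove (J '' S) := ⟨B, by rintro _ ⟨σ, -, rfl⟩; exact hB σ⟩
  set v := sSup (J '' S) with hv
  have hle : ∀ σ ∈ S, J σ ≤ v := fun σ hσ => le_csSup hbdd ⟨σ, hσ, rfl⟩
  have hex : ∀ n : ℕ, ∃ σ ∈ S, v - (1 / 2) ^ n < J σ := fun n => by
    obtain ⟨_, ⟨σ, hσ, rfl⟩, h⟩ := exists_lt_of_lt_csSup (hne.image J)
      (show v - (1 / 2 : ℝ) ^ n < sSup (J '' S) by linarith [show (0 : ℝ) < (1 / 2) ^ n by positivity])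
    exact ⟨σ, hσ, h⟩
  choose σ hσS hσ using hex
  let tail : ℕ → ℕ → StopTime 𝓕 := fun n k => σ (n + k)
  -- Since `J` is at most `v` at the minimum, modularity shows that the deficit of a maximum is at
  -- most the sum of the two deficits. The bound is the geometric sum of `(1 / 2) ^ j` over `n ≤ j ≤
  -- n + k`.
  have hrun : ∀ n k, StopTime.runMax (tail n) k ∈ S ∧
      v - 2 * (1 / 2) ^ n + (1 / 2) ^ (n + k) ≤ J (StopTime.runMax (tail n) k) := by
    intro n k
    induction k with
    | zero =>
      refine ⟨hσS _, ?_⟩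
      have := hσ n
      simp only [StopTime.runMax, tail, add_zero]
      linarith
    | succ k ih =>
      have hmem := hσS (n + (k + 1))
      refine ⟨hS.max _ ih.1 _ hmem, ?_⟩
      have h1 := hJ.modular (StopTime.runMax (tail n) k) (σ (n + (k + 1)))
      have h2 := hle _ (hS.min _ ih.1 _ hmem)
      have h3 := hσ (n + (k + 1))
      have h4 : (1 / 2 : ℝ) ^ (n + k) = 2 * (1 / 2) ^ (n + (k + 1)) := by
        rw [← add_assoc, pow_succ]; ring
      have h5 := ih.2
      change _ ≤ J ((StopTime.runMax (tail n) k).max (σ (n + (k + 1))))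
      linarith
  have hsup : ∀ n, StopTime.iSup (tail n) ∈ S ∧ v - 2 * (1 / 2) ^ n ≤ J (StopTime.iSup (tail n)) := by
    intro n
    have ht := StopTime.tendsto_runMax (tail n)
    refine ⟨hS.lim _ _ (fun k => (hrun n k).1) ht, ?_⟩
    refine ge_of_tendsto' (hJ.tendsto _ _ ht) fun k => ?_
    linarith [(hrun n k).2, show (0 : ℝ) < (1 / 2) ^ (n + k) by positivity]
  -- The tail suprema decrease in `n`; their infimum is a stopping time by right-continuity.
  have hlim : ∀ ω, Tendsto (fun n => (StopTime.iSup (tail n)).1 ω) atTop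
      (𝓝 ((StopTime.iInf h𝓕 fun n => StopTime.iSup (tail n)).1 ω)) := by
    intro ω
    refine tendsto_atTop_iInf (antitone_nat_of_succ_le fun n => ?_)
    refine iSup_le fun k => ?_
    have : tail (n + 1) k = tail n (k + 1) := by simp only [tail]; congr 1; omega
    rw [this]
    exact le_iSup (fun j => (tail n j).1 ω) (k + 1)
  refine ⟨_, hS.lim _ _ (fun n => (hsup n).1) hlim, fun ρ hρ => (hle ρ hρ).trans ?_⟩
  have h0 : Tendsto (fun n : ℕ => v - 2 * (1 / 2 : ℝ) ^ n) atTop (𝓝 (v - 2 * 0)) :=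
    tendsto_const_nhds.sub
      ((tendsto_pow_atTop_nhds_zero_of_lt_one (by norm_num) (by norm_num)).const_mul 2)
  have := le_of_tendsto_of_tendsto' h0 (hJ.tendsto _ _ hlim) fun n => (hsup n).2
  linarith

/-- The values at `σ ∨ ρ` and `σ ∧ ρ` sum to `2 * v` and neither exceeds `v`. A second functional
can therefore be maximized inside the set of maximizers. -/
theorem IsModular.isClosedLattice_argmax {J : StopTime 𝓕 → ℝ} (hJ : IsModular J)
    {S : Set (StopTime 𝓕)} (hS : IsClosedLattice S) {v : ℝ} (hv : ∀ ρ ∈ S, J ρ ≤ v) :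
    IsClosedLattice {σ | σ ∈ S ∧ J σ = v} where
  max := by
    rintro σ ⟨h1, h2⟩ ρ ⟨h3, h4⟩
    have h5 := hS.max _ h1 _ h3
    have h6 := hS.min _ h1 _ h3
    exact ⟨h5, by linarith [hJ.modular σ ρ, hv _ h5, hv _ h6]⟩
  min := by
    rintro σ ⟨h1, h2⟩ ρ ⟨h3, h4⟩
    have h5 := hS.max _ h1 _ h3
    have h6 := hS.min _ h1 _ h3
    exact ⟨h6, by linarith [hJ.modular σ ρ, hv _ h5, hv _ h6]⟩
  lim := by
    intro s σ hs hlim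
    refine ⟨hS.lim s σ (fun n => (hs n).1) hlim, ?_⟩
    refine tendsto_nhds_unique (hJ.tendsto s σ hlim) ?_
    simp only [fun n => (hs n).2]
    exact tendsto_const_nhds

theorem isClosedLattice_ge (τ : StopTime 𝓕) : IsClosedLattice {σ | ALE P τ σ} where
  max := fun _ hσ _ _ => ALE.trans hσ (ale_max_left _ _)
  min := fun _ hσ _ hρ => ALE.min hσ hρ
  lim := by
    intro s σ hs hlim
    filter_upwards [ae_all_iff.2 hs] with ω hω
    exact ge_of_tendsto' (hlim ω) hω

theorem isModular_integral [IsFiniteMeasure P] {f : WithTop ℝ≥0 → Ω → ℝ} {bd : Ω → ℝ}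
    (hbd : Integrable bd P)
    (hf : ∀ σ : StopTime 𝓕, Integrable (fun ω => f (σ.1 ω) ω) P)
    (hle : ∀ᵐ ω ∂P, ∀ t, ‖f t ω‖ ≤ bd ω)
    (hcont : ∀ᵐ ω ∂P, ∀ (t : ℕ → WithTop ℝ≥0) (a : WithTop ℝ≥0), Tendsto t atTop (𝓝 a) →
      Tendsto (fun n => f (t n) ω) atTop (𝓝 (f a ω))) :
    IsModular (fun σ : StopTime 𝓕 => ∫ ω, f (σ.1 ω) ω ∂P) where
  modular := by
    intro σ ρ
    rw [← integral_add (hf _) (hf _), ← integral_add (hf _) (hf _)]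
    congr 1
    ext ω
    simp only [StopTime.max_apply, StopTime.min_apply]
    rcases le_total (σ.1 ω) (ρ.1 ω) with h | h
    · rw [max_eq_right h, min_eq_left h, add_comm]
    · rw [max_eq_left h, min_eq_right h]
  tendsto := by
    intro s σ hlim
    refine tendsto_integral_of_dominated_convergence bd (fun n => (hf _).aestronglyMeasurable) hbd
      (fun n => ?_) ?_
    · filter_upwards [hle] with ω h using h _
    · filter_upwards [hcont] with ω h using h _ _ (hlim ω)
  bounded := by
    refine ⟨∫ ω, bd ω ∂P, fun σ => integral_mono_ae (hf σ) hbd ?_⟩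
    filter_upwards [hle] with ω h using (le_abs_self _).trans (h _)

theorem isModular_integral_cum [IsFiniteMeasure P] {X : ℝ≥0 → Ω → ℝ} (hX : ProdIntegrable P X) :
    IsModular (fun σ : StopTime 𝓕 => ∫ ω, cum X (σ.1 ω) ω ∂P) := by
  refine isModular_integral (Integrable.integral_prod_left (Integrable.norm hX))
    (fun σ => hX.integrable_cum σ.measurable) ?_ ?_
  · filter_upwards [hX.ae_integrable] with ω h t using norm_cum_le h t
  · filter_upwards [hX.ae_integrable] with ω h t a ht using tendsto_cum h ht

/-- Turns the search for a latest stopping time into maximizing the expectation of a strictly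
increasing bounded function of time. -/
theorem exists_bounded_clock :
    ∃ φ : WithTop ℝ≥0 → ℝ, StrictMono φ ∧ Continuous φ ∧ ∀ t, ‖φ t‖ ≤ 1 := by
  let e : WithTop ℝ≥0 ≃o Set.Icc (0 : ℝ) 1 := ENNReal.orderIsoUnitIntervalBirational
  refine ⟨fun t => (e t : ℝ), fun a b h => e.strictMono h,
    continuous_subtype_val.comp e.continuous, fun t => ?_⟩
  rw [Real.norm_of_nonneg (e t).2.1]
  exact (e t).2.2

/-- Every closed lattice of stopping times has an a.s. latest maximizer of a modular functional. -/
theorem IsModular.exists_latest_max [IsProbabilityMeasure P] (h𝓕 : 𝓕.IsRightContinuous)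
    {J : StopTime 𝓕 → ℝ}
    (hJ : IsModular J) {S : Set (StopTime 𝓕)} (hS : IsClosedLattice S) (hne : S.Nonempty) :
    ∃ σ ∈ S, (∀ ρ ∈ S, J ρ ≤ J σ) ∧ ∀ ρ ∈ S, J σ ≤ J ρ → ALE P ρ σ := by
  obtain ⟨σ₀, hσ₀, hmax⟩ := hJ.exists_max h𝓕 hS hne
  obtain ⟨φ, hφm, hφc, hφb⟩ := exists_bounded_clock
  have hφi : ∀ σ : StopTime 𝓕, Integrable (fun ω => φ (σ.1 ω)) P := fun σ =>
    (integrable_const (1 : ℝ)).mono' (hφc.measurable.comp σ.measurable).aestronglyMeasurable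
      (Eventually.of_forall fun ω => hφb _)
  have hΨ : IsModular (fun σ : StopTime 𝓕 => ∫ ω, φ (σ.1 ω) ∂P) :=
    isModular_integral (f := fun t _ => φ t) (integrable_const (1 : ℝ)) hφi
      (Eventually.of_forall fun ω => hφb)
      (Eventually.of_forall fun ω t a ht => (hφc.tendsto a).comp ht)
  have hA := hJ.isClosedLattice_argmax hS hmax
  obtain ⟨σ, ⟨hσ, hσv⟩, hlast⟩ := hΨ.exists_max h𝓕 hA ⟨σ₀, hσ₀, rfl⟩
  refine ⟨σ, hσ, fun ρ hρ => hσv ▸ hmax ρ hρ, fun ρ hρ hle => ?_⟩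
  -- `ρ ∨ σ` is again a maximizer of `J`, so its expected clock value cannot exceed that of `σ`;
  -- strict monotonicity then gives `ρ ∨ σ = σ` a.s.
  have h1 := hlast _ (hA.max _ ⟨hρ, le_antisymm (hmax ρ hρ) (hσv ▸ hle)⟩ _ ⟨hσ, hσv⟩)
  have hnn : 0 ≤ᵐ[P] fun ω => φ ((ρ.max σ).1 ω) - φ (σ.1 ω) :=
    Eventually.of_forall fun ω => sub_nonneg.2 (hφm.monotone (le_max_right _ _))
  have h2 : ∫ ω, φ ((ρ.max σ).1 ω) - φ (σ.1 ω) ∂P = 0 := by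
    refine le_antisymm ?_ (integral_nonneg_of_ae hnn)
    rw [integral_sub (hφi _) (hφi _)]
    linarith
  have h3 := (integral_eq_zero_iff_of_nonneg_ae hnn ((hφi _).sub (hφi _))).1 h2
  filter_upwards [h3] with ω hω
  have h4 : (ρ.max σ).1 ω = σ.1 ω := hφm.injective (sub_eq_zero.1 hω)
  exact h4 ▸ le_max_left _ _

end

/-! ### From conditional to unconditional optimality. -/

section
variable {Ω : Type*} {m : MeasurableSpace Ω} {𝓕 : Filtration ℝ≥0 m} {P : Measure Ω}
  {X : ℝ≥0 → Ω → ℝ}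

theorem condExp_le_condExp_of_forall_setIntegral_le [IsFiniteMeasure P] {m' : MeasurableSpace Ω}
    (hm : m' ≤ m) {f g : Ω → ℝ} (hf : Integrable f P) (hg : Integrable g P)
    (h : ∀ C, MeasurableSet[m'] C → ∫ ω in C, f ω ∂P ≤ ∫ ω in C, g ω ∂P) :
    P[f|m'] ≤ᵐ[P] P[g|m'] := by
  refine ae_le_of_ae_le_trim (hm := hm) ?_
  refine ae_le_of_forall_setIntegral_le (integrable_condExp.trim hm stronglyMeasurable_condExp)
    (integrable_condExp.trim hm stronglyMeasurable_condExp) fun C hC _ => ?_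
  rw [← setIntegral_trim hm stronglyMeasurable_condExp hC,
    ← setIntegral_trim hm stronglyMeasurable_condExp hC, setIntegral_condExp hm hf hC,
    setIntegral_condExp hm hg hC]
  exact h C hC

theorem setIntegral_le_of_condExp_le [IsFiniteMeasure P] {m' : MeasurableSpace Ω}
    (hm : m' ≤ m) {f g : Ω → ℝ} (hf : Integrable f P) (hg : Integrable g P)
    (h : P[f|m'] ≤ᵐ[P] P[g|m']) {C : Set Ω} (hC : MeasurableSet[m'] C) :
    ∫ ω in C, f ω ∂P ≤ ∫ ω in C, g ω ∂P := by
  rw [← setIntegral_condExp hm hf hC, ← setIntegral_condExp hm hg hC]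
  exact integral_mono_ae integrable_condExp.integrableOn integrable_condExp.integrableOn
    (ae_restrict_of_ae h)

theorem ProdIntegrable.integrable_cum_stopTime (hX : ProdIntegrable P X) (σ : StopTime 𝓕) :
    Integrable (fun ω => cum X (σ.1 ω) ω) P :=
  hX.integrable_cum σ.measurable

theorem ProdIntegrable.integrable_cum_top (hX : ProdIntegrable P X) :
    Integrable (fun ω => cum X ⊤ ω) P :=
  hX.integrable_cum (τ := fun _ => ⊤) measurable_const

/-- The expected accrued revenue `E[∫_0^σ X_s ds]`. -/
def meanCum (P : Measure Ω) (X : ℝ≥0 → Ω → ℝ) (σ : StopTime 𝓕) : ℝ :=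
  ∫ ω, cum X (σ.1 ω) ω ∂P

theorem ProdIntegrable.isModular_meanCum [IsFiniteMeasure P] (hX : ProdIntegrable P X) :
    IsModular (𝓕 := 𝓕) (meanCum P X) :=
  isModular_integral_cum hX

theorem ProdIntegrable.meanCum_eq (hX : ProdIntegrable P X) {C : Set Ω}
    (hC : MeasurableSet C) (σ : StopTime 𝓕) :
    meanCum P X σ = ∫ ω in C, cum X (σ.1 ω) ω ∂P + ∫ ω in Cᶜ, cum X (σ.1 ω) ω ∂P :=
  (integral_add_compl hC (hX.integrable_cum_stopTime σ)).symm

theorem ProdIntegrable.meanCum_paste (hX : ProdIntegrable P X) {C : Set Ω} {σ ρ : StopTime 𝓕}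
    (hσ : MeasurableSet[σ.past] C) (hρ : MeasurableSet[ρ.past] C) :
    meanCum P X (StopTime.paste C σ ρ hσ hρ) =
      ∫ ω in C, cum X (σ.1 ω) ω ∂P + ∫ ω in Cᶜ, cum X (ρ.1 ω) ω ∂P := by
  have hC := σ.past_le _ hσ
  rw [hX.meanCum_eq hC]
  congr 1
  · refine setIntegral_congr_fun hC fun ω hω => ?_
    simp only [StopTime.paste_of_mem hω]
  · refine setIntegral_congr_fun hC.compl fun ω hω => ?_
    simp only [StopTime.paste_of_notMem hω]

/-- A set of stopping times that is stable under switching at events known at `ϑ`. -/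
def PasteStable (ϑ : StopTime 𝓕) (A : Set (StopTime 𝓕)) : Prop :=
  ∀ σ ∈ A, ∀ ρ ∈ A, ∀ C, MeasurableSet[ϑ.past] C → ∀ (hσ : MeasurableSet[σ.past] C)
    (hρ : MeasurableSet[ρ.past] C), StopTime.paste C σ ρ hσ hρ ∈ A

theorem ale_paste {ϑ σ ρ : StopTime 𝓕} (h : ALE P ϑ σ) (h' : ALE P ϑ ρ) {C : Set Ω}
    {hσ : MeasurableSet[σ.past] C} {hρ : MeasurableSet[ρ.past] C} :
    ALE P ϑ (StopTime.paste C σ ρ hσ hρ) := by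
  filter_upwards [h, h'] with ω h1 h2
  by_cases hω : ω ∈ C
  · rwa [StopTime.paste_of_mem hω]
  · rwa [StopTime.paste_of_notMem hω]

theorem paste_ale {ϑ σ ρ : StopTime 𝓕} (h : ALE P σ ϑ) (h' : ALE P ρ ϑ) {C : Set Ω}
    {hσ : MeasurableSet[σ.past] C} {hρ : MeasurableSet[ρ.past] C} :
    ALE P (StopTime.paste C σ ρ hσ hρ) ϑ := by
  filter_upwards [h, h'] with ω h1 h2
  by_cases hω : ω ∈ C
  · rwa [StopTime.paste_of_mem hω]
  · rwa [StopTime.paste_of_notMem hω]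

theorem pasteStable_ge (ϑ : StopTime 𝓕) : PasteStable ϑ {σ | ALE P ϑ σ} :=
  fun _ hσ _ hρ _ _ _ _ => ale_paste hσ hρ

theorem pasteStable_Icc (ϑ κ : StopTime 𝓕) : PasteStable ϑ {σ | ALE P ϑ σ ∧ ALE P σ κ} :=
  fun _ hσ _ hρ _ _ _ _ => ⟨ale_paste hσ.1 hρ.1, paste_ale hσ.2 hρ.2⟩

/-- A stopping time that is optimal in expectation is optimal on every event known at the
beginning. -/
theorem UsualConditions.setIntegral_cum_le_of_meanCum_le (h𝓕 : UsualConditions P 𝓕)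
    (hX : ProdIntegrable P X) {ϑ : StopTime 𝓕} {A : Set (StopTime 𝓕)}
    (hA : ∀ ρ ∈ A, ALE P ϑ ρ) (hp : PasteStable ϑ A) {σ : StopTime 𝓕} (hσ : σ ∈ A)
    (hmax : ∀ ρ ∈ A, meanCum P X ρ ≤ meanCum P X σ) {ρ : StopTime 𝓕} (hρ : ρ ∈ A) {C : Set Ω}
    (hC : MeasurableSet[ϑ.past] C) :
    ∫ ω in C, cum X (ρ.1 ω) ω ∂P ≤ ∫ ω in C, cum X (σ.1 ω) ω ∂P := by
  have h1 := h𝓕.past_mono (hA _ hρ) _ hC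
  have h2 := h𝓕.past_mono (hA _ hσ) _ hC
  -- The competitor follows `ρ` on `C` and `σ` off `C`; the contributions off `C` cancel.
  have := hmax _ (hp ρ hρ σ hσ C hC h1 h2)
  rw [hX.meanCum_paste, hX.meanCum_eq (ϑ.past_le _ hC) σ] at this
  linarith

section
variable [IsFiniteMeasure P] {ϑ : StopTime 𝓕} {A : Set (StopTime 𝓕)} {k : Ω → ℝ}
  {V : StopTime 𝓕 → Ω → ℝ}

theorem setIntegral_cum_le_of_attains (hX : ProdIntegrable P X) (hk : Integrable k P)
    (hV : ∀ ρ ∈ A, V ρ =ᵐ[P] P[fun ω => cum X (ρ.1 ω) ω + k ω|ϑ.past]) {σ : StopTime 𝓕}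
    (hσ : Attains P A V σ) {ρ : StopTime 𝓕} (hρ : ρ ∈ A) {C : Set Ω}
    (hC : MeasurableSet[ϑ.past] C) :
    ∫ ω in C, cum X (ρ.1 ω) ω ∂P ≤ ∫ ω in C, cum X (σ.1 ω) ω ∂P := by
  have h1 := hX.integrable_cum_stopTime ρ
  have h2 := hX.integrable_cum_stopTime σ
  have := setIntegral_le_of_condExp_le ϑ.past_le (h1.add hk) (h2.add hk)
    ((hV ρ hρ).symm.trans_le ((hσ.2 ρ hρ).trans_eq (hV σ hσ.1))) hC
  simp only [Pi.add_apply] at this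
  rw [integral_add h1.integrableOn hk.integrableOn,
    integral_add h2.integrableOn hk.integrableOn] at this
  linarith

theorem attains_of_setIntegral_cum_le (hX : ProdIntegrable P X) (hk : Integrable k P)
    (hV : ∀ ρ ∈ A, V ρ =ᵐ[P] P[fun ω => cum X (ρ.1 ω) ω + k ω|ϑ.past]) {σ : StopTime 𝓕}
    (hσ : σ ∈ A) (h : ∀ ρ ∈ A, ∀ C, MeasurableSet[ϑ.past] C →
      ∫ ω in C, cum X (ρ.1 ω) ω ∂P ≤ ∫ ω in C, cum X (σ.1 ω) ω ∂P) :
    Attains P A V σ := by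
  refine ⟨hσ, fun ρ hρ => (hV ρ hρ).trans_le (EventuallyLE.trans_eq ?_ (hV σ hσ).symm)⟩
  have h1 := hX.integrable_cum_stopTime ρ
  have h2 := hX.integrable_cum_stopTime σ
  refine condExp_le_condExp_of_forall_setIntegral_le ϑ.past_le (h1.add hk) (h2.add hk)
    fun C hC => ?_
  rw [integral_add h1.integrableOn hk.integrableOn, integral_add h2.integrableOn hk.integrableOn]
  linarith [h ρ hρ C hC]

/-- The summand `k` is common to all competitors and drops out; stability under pasting localizes an
inequality of means to every event known at `ϑ`. -/
theorem UsualConditions.attains_iff_meanCum (h𝓕 : UsualConditions P 𝓕) (hX : ProdIntegrable P X)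
    (hk : Integrable k P) (hA : ∀ ρ ∈ A, ALE P ϑ ρ) (hp : PasteStable ϑ A)
    (hV : ∀ ρ ∈ A, V ρ =ᵐ[P] P[fun ω => cum X (ρ.1 ω) ω + k ω|ϑ.past]) {σ : StopTime 𝓕} :
    Attains P A V σ ↔ σ ∈ A ∧ ∀ ρ ∈ A, meanCum P X ρ ≤ meanCum P X σ := by
  constructor
  · intro h
    refine ⟨h.1, fun ρ hρ => ?_⟩
    simpa [meanCum] using setIntegral_cum_le_of_attains hX hk hV h hρ MeasurableSet.univ
  · rintro ⟨hσ, h⟩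
    exact attains_of_setIntegral_cum_le hX hk hV hσ fun ρ hρ C hC =>
      h𝓕.setIntegral_cum_le_of_meanCum_le hX hA hp hσ h hρ hC

end

/-! ### Reaction times of the follower. -/

namespace Duopoly

variable (D : Duopoly P 𝓕)

theorem prodIntegrable_π0 (i : Firm) : ProdIntegrable P (D.π0 i) := (D.revenue_π0 i).integrable
theorem prodIntegrable_πL (i : Firm) : ProdIntegrable P (D.πL i) := (D.revenue_πL i).integrable
theorem prodIntegrable_πF (i : Firm) : ProdIntegrable P (D.πF i) := (D.revenue_πF i).integrable
theorem prodIntegrable_πB (i : Firm) : ProdIntegrable P (D.πB i) := (D.revenue_πB i).integrable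

/-- The revenue `π^F - π^B` that a laggard gains by waiting. -/
def waitGain (i : Firm) : ℝ≥0 → Ω → ℝ := fun s ω => D.πF i s ω - D.πB i s ω

theorem prodIntegrable_waitGain (i : Firm) : ProdIntegrable P (D.waitGain i) :=
  (D.prodIntegrable_πF i).sub (D.prodIntegrable_πB i)

variable [IsProbabilityMeasure P]

theorem cum_waitGain (i : Firm) :
    ∀ᵐ ω ∂P, ∀ t, cum (D.waitGain i) t ω = cum (D.πF i) t ω - cum (D.πB i) t ω := by
  filter_upwards [(D.prodIntegrable_πF i).ae_integrable, (D.prodIntegrable_πB i).ae_integrable]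
    with ω h1 h2 t using cum_sub h1 h2

theorem followValue_ae_eq (i : Firm) {τ ρ : StopTime 𝓕} (h : ALE P τ ρ) :
    D.followValue i τ ρ =ᵐ[P] P[fun ω => cum (D.waitGain i) (ρ.1 ω) ω +
      (cum (D.πB i) ⊤ ω - cum (D.πF i) (τ.1 ω) ω)|τ.past] := by
  refine condExp_congr_ae ?_
  filter_upwards [(D.prodIntegrable_πF i).ae_integrable, (D.prodIntegrable_πB i).ae_integrable,
    D.cum_waitGain i, h] with ω h1 h2 h3 h4
  rw [accrued_eq h1 h4, accruedFrom_eq h2, h3]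
  ring

theorem attains_followValue_iff (h𝓕 : UsualConditions P 𝓕) (i : Firm) {τ σ : StopTime 𝓕} :
    Attains P {τ' | ALE P τ τ'} (D.followValue i τ) σ ↔ ALE P τ σ ∧
      ∀ ρ, ALE P τ ρ → meanCum P (D.waitGain i) ρ ≤ meanCum P (D.waitGain i) σ :=
  h𝓕.attains_iff_meanCum (D.prodIntegrable_waitGain i)
    (((D.prodIntegrable_πB i).integrable_cum_top).sub
      ((D.prodIntegrable_πF i).integrable_cum_stopTime τ))
    (fun _ h => h) (pasteStable_ge τ) (fun _ h => D.followValue_ae_eq i h)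

theorem isFollowerTime_followerTime (h𝓕 : UsualConditions P 𝓕) (i : Firm) (τ : StopTime 𝓕) :
    D.IsFollowerTime i τ (D.followerTime i τ) := by
  have hex : ∃ σ, D.IsFollowerTime i τ σ := by
    obtain ⟨σ, h1, h2, h3⟩ := (D.prodIntegrable_waitGain i).isModular_meanCum.exists_latest_max
      (P := P) h𝓕.rightContinuous (isClosedLattice_ge (P := P) τ) ⟨τ, ALE.refl τ⟩
    refine ⟨σ, (D.attains_followValue_iff h𝓕 i).2 ⟨h1, h2⟩, fun ρ hρ => ?_⟩
    rw [D.attains_followValue_iff h𝓕] at hρ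
    exact h3 ρ hρ.1 (hρ.2 σ h1)
  rw [followerTime, dif_pos hex]
  exact hex.choose_spec

theorem attains_followerTime (h𝓕 : UsualConditions P 𝓕) (i : Firm) (τ : StopTime 𝓕) :
    Attains P {τ' | ALE P τ τ'} (D.followValue i τ) (D.followerTime i τ) :=
  (D.isFollowerTime_followerTime h𝓕 i τ).1

theorem ale_followerTime (h𝓕 : UsualConditions P 𝓕) (i : Firm) (τ : StopTime 𝓕) : ALE P τ (D.followerTime i τ) :=
  (D.attains_followerTime h𝓕 i τ).1

theorem meanCum_le_followerTime (h𝓕 : UsualConditions P 𝓕) (i : Firm) {τ ρ : StopTime 𝓕} (h : ALE P τ ρ) :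
    meanCum P (D.waitGain i) ρ ≤ meanCum P (D.waitGain i) (D.followerTime i τ) :=
  ((D.attains_followValue_iff h𝓕 i).1 (D.attains_followerTime h𝓕 i τ)).2 ρ h

theorem ale_followerTime_of_meanCum_le (h𝓕 : UsualConditions P 𝓕) (i : Firm) {τ ρ : StopTime 𝓕} (h : ALE P τ ρ)
    (h' : meanCum P (D.waitGain i) (D.followerTime i τ) ≤ meanCum P (D.waitGain i) ρ) :
    ALE P ρ (D.followerTime i τ) := by
  refine (D.isFollowerTime_followerTime h𝓕 i τ).2 ρ ((D.attains_followValue_iff h𝓕 i).2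
    ⟨h, fun κ hκ => (D.meanCum_le_followerTime h𝓕 i hκ).trans h'⟩)

/-- Exchange argument: on `C` each reaction time is admissible for the other problem. Using the
reaction to `τ` on `C` cannot improve the problem at `τ'`, so using the reaction to `τ'` on `C` is
optimal for the problem at `τ`, and the latest optimizer dominates it. -/
theorem followerTime_le_on (h𝓕 : UsualConditions P 𝓕) (i : Firm) {τ τ' : StopTime 𝓕} {C : Set Ω} 
    (hC : MeasurableSet[(D.followerTime i τ).past] C)
    (hC' : MeasurableSet[(D.followerTime i τ').past] C)
    (h : ∀ᵐ ω ∂P, ω ∈ C → τ.1 ω ≤ (D.followerTime i τ').1 ω)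
    (h' : ∀ᵐ ω ∂P, ω ∈ C → τ'.1 ω ≤ (D.followerTime i τ).1 ω) :
    ∀ᵐ ω ∂P, ω ∈ C → (D.followerTime i τ').1 ω ≤ (D.followerTime i τ).1 ω := by
  have g := D.ale_followerTime h𝓕 i τ
  have g' := D.ale_followerTime h𝓕 i τ'
  have hX := D.prodIntegrable_waitGain i
  have hCm := StopTime.past_le _ _ hC
  have key : ∀ {ϑ σ ρ : StopTime 𝓕} (hσ : MeasurableSet[σ.past] C) (hρ : MeasurableSet[ρ.past] C),
      (∀ᵐ ω ∂P, ω ∈ C → ϑ.1 ω ≤ σ.1 ω) → ALE P ϑ ρ →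
      ALE P ϑ (StopTime.paste C σ ρ hσ hρ) := by
    intro ϑ σ ρ hσ hρ h1 h2
    filter_upwards [h1, h2] with ω h3 h4
    by_cases hω : ω ∈ C
    · rw [StopTime.paste_of_mem hω]; exact h3 hω
    · rwa [StopTime.paste_of_notMem hω]
  have e1 := D.meanCum_le_followerTime h𝓕 i (key hC hC' h' g')
  rw [hX.meanCum_paste, hX.meanCum_eq hCm (D.followerTime i τ')] at e1
  have e2 := D.ale_followerTime_of_meanCum_le h𝓕 i (key hC' hC h g) (by
    rw [hX.meanCum_paste, hX.meanCum_eq hCm (D.followerTime i τ)]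
    linarith)
  filter_upwards [e2] with ω h5 hω
  rwa [StopTime.paste_of_mem hω] at h5

/-- Reaction times to `τ` and `τ'` agree on every event, known at both reaction times, on which neither
reaction has occurred yet when the opponent's other investment time arrives. -/
theorem followerTime_eq_on (h𝓕 : UsualConditions P 𝓕) (i : Firm) {τ τ' : StopTime 𝓕} {C : Set Ω} 
    (hC : MeasurableSet[(D.followerTime i τ).past] C)
    (hC' : MeasurableSet[(D.followerTime i τ').past] C)
    (h : ∀ᵐ ω ∂P, ω ∈ C → τ.1 ω ≤ (D.followerTime i τ').1 ω)
    (h' : ∀ᵐ ω ∂P, ω ∈ C → τ'.1 ω ≤ (D.followerTime i τ).1 ω) :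
    ∀ᵐ ω ∂P, ω ∈ C → (D.followerTime i τ).1 ω = (D.followerTime i τ').1 ω := by
  filter_upwards [D.followerTime_le_on h𝓕 i hC hC' h h', D.followerTime_le_on h𝓕 i hC' hC h' h]
    with ω h1 h2 hω using le_antisymm (h2 hω) (h1 hω)

/-- The reaction time is unchanged if the opponent invests later, but before the reaction. -/
theorem followerTime_consistent (h𝓕 : UsualConditions P 𝓕) (i : Firm) {ϑ τ : StopTime 𝓕} (h : ALE P ϑ τ) :
    ∀ᵐ ω ∂P, τ.1 ω ≤ (D.followerTime i ϑ).1 ω →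
      (D.followerTime i τ).1 ω = (D.followerTime i ϑ).1 ω := by
  refine D.followerTime_eq_on h𝓕 i (C := {ω | τ.1 ω ≤ (D.followerTime i ϑ).1 ω})
    (h𝓕.past_mono (D.ale_followerTime h𝓕 i τ) _ (τ.2.measurableSet_le_stopping_time (D.followerTime i ϑ).2))
    (τ.2.measurableSet_stopping_time_le (D.followerTime i ϑ).2) (Eventually.of_forall fun _ h => h) ?_
  filter_upwards [h.trans (D.ale_followerTime h𝓕 i τ)] with ω h1 _ using h1

/-- The firm that gains more from investing as laggard reacts earlier. -/
theorem followerTime_one_le_two (h𝓕 : UsualConditions P 𝓕) (τ : StopTime 𝓕) :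
    ALE P (D.followerTime .one τ) (D.followerTime .two τ) := by
  set a := D.followerTime .one τ with ha
  set b := D.followerTime .two τ with hb
  have h1 := D.ale_followerTime h𝓕 .one τ
  have h2 := D.ale_followerTime h𝓕 .two τ
  have h3 := D.meanCum_le_followerTime h𝓕 .one (h1.min h2)
  have h4 := (D.prodIntegrable_waitGain .one).isModular_meanCum.modular a b
  -- By `h3` and `h4`, firm 1 does not lose by moving from `b` to `a ∨ b`. Firm 2's gain from
  -- waiting is at least as large, so `a ∨ b` is optimal for firm 2 and cannot exceed its latest
  -- optimizer `b`.
  have h5 : meanCum P (D.waitGain .one) (a.max b) - meanCum P (D.waitGain .one) b ≤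
      meanCum P (D.waitGain .two) (a.max b) - meanCum P (D.waitGain .two) b := by
    simp only [meanCum]
    have i1 := (D.prodIntegrable_waitGain .one).integrable_cum_stopTime (a.max b)
    have i2 := (D.prodIntegrable_waitGain .one).integrable_cum_stopTime b
    have i3 := (D.prodIntegrable_waitGain .two).integrable_cum_stopTime (a.max b)
    have i4 := (D.prodIntegrable_waitGain .two).integrable_cum_stopTime b
    rw [← integral_sub i1 i2, ← integral_sub i3 i4]
    refine integral_mono_ae (i1.sub i2) (i3.sub i4) ?_
    have := cum_sub_cum_le (D.prodIntegrable_waitGain .one) (D.prodIntegrable_waitGain .two) (by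
      filter_upwards [D.gainB_le] with p hp
      simp only [waitGain]
      linarith)
    filter_upwards [this] with ω hω using hω _ _ (le_max_right _ _)
  exact (ale_max_left _ _).trans (D.ale_followerTime_of_meanCum_le h𝓕 .two
    (h2.trans (ale_max_right _ _)) (by linarith))

end Duopoly
end

/-! ### Payoffs as conditional expectations of realized payoffs. -/

section
variable {Ω : Type*} {m : MeasurableSpace Ω} {𝓕 : Filtration ℝ≥0 m} {P : Measure Ω}

theorem condExp_eq_condExp_of_forall_setIntegral_eq [IsFiniteMeasure P] {m' : MeasurableSpace Ω}
    (hm : m' ≤ m) {f g : Ω → ℝ} (hf : Integrable f P) (hg : Integrable g P)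
    (h : ∀ C, MeasurableSet[m'] C → ∫ ω in C, f ω ∂P = ∫ ω in C, g ω ∂P) :
    P[f|m'] =ᵐ[P] P[g|m'] :=
  (condExp_le_condExp_of_forall_setIntegral_le hm hf hg fun C hC => (h C hC).le).antisymm
    (condExp_le_condExp_of_forall_setIntegral_le hm hg hf fun C hC => (h C hC).ge)

theorem setIntegral_add_condExp [IsFiniteMeasure P] {m' : MeasurableSpace Ω}
    (hm : m' ≤ m) {f g : Ω → ℝ} (hf : Integrable f P) (hg : Integrable g P) {C : Set Ω}
    (hC : MeasurableSet[m'] C) :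
    ∫ ω in C, (f ω + (P[g|m']) ω) ∂P = ∫ ω in C, (f ω + g ω) ∂P := by
  rw [integral_add hf.integrableOn integrable_condExp.integrableOn, setIntegral_condExp hm hg hC,
    integral_add hf.integrableOn hg.integrableOn]

theorem setIntegral_add_indicator {f g h : Ω → ℝ} {A B C S : Set Ω} (hA : MeasurableSet A)
    (hB : MeasurableSet B) (hC : MeasurableSet C) (hf : Integrable f P) (hg : Integrable g P)
    (hh : Integrable h P) :
    ∫ ω in S, (A.indicator f ω + B.indicator g ω + C.indicator h ω) ∂P =
      ∫ ω in S ∩ A, f ω ∂P + ∫ ω in S ∩ B, g ω ∂P + ∫ ω in S ∩ C, h ω ∂P := by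
  have a1 := (hf.indicator hA).integrableOn (s := S)
  have a2 := (hg.indicator hB).integrableOn (s := S)
  have a3 := (hh.indicator hC).integrableOn (s := S)
  rw [integral_add (f := fun ω => A.indicator f ω + B.indicator g ω) (a1.add a2) a3,
    integral_add a1 a2, setIntegral_indicator hA, setIntegral_indicator hB,
    setIntegral_indicator hC]

theorem IsFamilyEssSup.ae_eq_of_mem {S : Set (Ω → ℝ)} {g f : Ω → ℝ} (hg : IsFamilyEssSup P S g)
    (hf : f ∈ S) (hm : AEMeasurable f P) (h : ∀ f' ∈ S, f' ≤ᵐ[P] f) : g =ᵐ[P] f :=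
  (hg.2.2 f hm h).antisymm (hg.2.1 f hf)

/-- A largest member is an essential supremum, so the default `0` plays no role. It applies to the
follower problem, whose value is attained at the reaction time. -/
theorem familyEssSup_ae_eq_of_mem {S : Set (Ω → ℝ)} {f : Ω → ℝ}
    (hf : f ∈ S) (hm : AEMeasurable f P) (h : ∀ f' ∈ S, f' ≤ᵐ[P] f) : familyEssSup P S =ᵐ[P] f := by
  have hex : ∃ g, IsFamilyEssSup P S g := ⟨f, hm, h, fun _ _ h' => h' f hf⟩
  rw [familyEssSup, dif_pos hex]
  exact hex.choose_spec.ae_eq_of_mem hf hm h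

theorem StopTime.measurableSet_lt_left (τ σ : StopTime 𝓕) :
    MeasurableSet[τ.past] {ω | τ.1 ω < σ.1 ω} := by
  have := (σ.2.measurableSet_stopping_time_le τ.2).compl
  simpa only [Set.compl_ofPred, not_le] using this

theorem StopTime.measurableSet_eq (τ σ : StopTime 𝓕) :
    MeasurableSet[τ.past] {ω | τ.1 ω = σ.1 ω} :=
  τ.2.measurableSet_eq_stopping_time σ.2

namespace Duopoly

variable (D : Duopoly P 𝓕)

/-- The realized payoff of firm `i` if it leads at `τ` and is followed at `κ ≥ τ`. -/
def leadPath (i : Firm) (τ κ : StopTime 𝓕) (ω : Ω) : ℝ :=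
  cum (D.π0 i) (τ.1 ω) ω + (cum (D.πL i) (κ.1 ω) ω - cum (D.πL i) (τ.1 ω) ω +
    (cum (D.πB i) ⊤ ω - cum (D.πB i) (κ.1 ω) ω))

/-- The realized payoff of firm `i` if its opponent leads at `τ` and it follows at `κ ≥ τ`. -/
def followPath (i : Firm) (τ κ : StopTime 𝓕) (ω : Ω) : ℝ :=
  cum (D.π0 i) (τ.1 ω) ω + (cum (D.πF i) (κ.1 ω) ω - cum (D.πF i) (τ.1 ω) ω +
    (cum (D.πB i) ⊤ ω - cum (D.πB i) (κ.1 ω) ω))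

/-- The realized payoff of firm `i` if both firms invest at `τ`. -/
def simPath (i : Firm) (τ : StopTime 𝓕) (ω : Ω) : ℝ :=
  cum (D.π0 i) (τ.1 ω) ω + (cum (D.πB i) ⊤ ω - cum (D.πB i) (τ.1 ω) ω)

open Classical in
/-- The realized payoff of firm `i` under the plans `τi` and `τj`. -/
def outcomePath (i : Firm) (τi τj : StopTime 𝓕) (ω : Ω) : ℝ :=
  if τi.1 ω < τj.1 ω then D.leadPath i τi (D.followerTime i.other τi) ω
  else if τj.1 ω < τi.1 ω then D.followPath i τj (D.followerTime i τj) ω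
  else D.simPath i τi ω

/-- The payoff whose conditional expectation is `payoff`. -/
def outcome (i : Firm) (τi τj : StopTime 𝓕) (ω : Ω) : ℝ :=
  {ω | τi.1 ω < τj.1 ω}.indicator (D.leader i τi) ω +
    {ω | τj.1 ω < τi.1 ω}.indicator (D.follower i τj) ω +
    {ω | τi.1 ω = τj.1 ω}.indicator (D.simultaneous i τi) ω

variable (i : Firm) (τ κ : StopTime 𝓕)

theorem integrable_continuation {X Y : ℝ≥0 → Ω → ℝ} (hX : ProdIntegrable P X)
    (hY : ProdIntegrable P Y) : Integrable (fun ω => cum X (κ.1 ω) ω - cum X (τ.1 ω) ω +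
    (cum Y ⊤ ω - cum Y (κ.1 ω) ω)) P :=
  ((hX.integrable_cum_stopTime κ).sub (hX.integrable_cum_stopTime τ)).add
    (hY.integrable_cum_top.sub (hY.integrable_cum_stopTime κ))

theorem integrable_leadPath : Integrable (D.leadPath i τ κ) P :=
  ((D.prodIntegrable_π0 i).integrable_cum_stopTime τ).add
    (integrable_continuation τ κ (D.prodIntegrable_πL i) (D.prodIntegrable_πB i))

theorem integrable_followPath : Integrable (D.followPath i τ κ) P :=
  ((D.prodIntegrable_π0 i).integrable_cum_stopTime τ).add
    (integrable_continuation τ κ (D.prodIntegrable_πF i) (D.prodIntegrable_πB i))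

theorem integrable_simPath : Integrable (D.simPath i τ) P :=
  ((D.prodIntegrable_π0 i).integrable_cum_stopTime τ).add
    ((D.prodIntegrable_πB i).integrable_cum_top.sub
      ((D.prodIntegrable_πB i).integrable_cum_stopTime τ))

theorem outcomePath_eq_indicator (τi τj : StopTime 𝓕) : D.outcomePath i τi τj = fun ω =>
    {ω | τi.1 ω < τj.1 ω}.indicator (D.leadPath i τi (D.followerTime i.other τi)) ω +
    {ω | τj.1 ω < τi.1 ω}.indicator (D.followPath i τj (D.followerTime i τj)) ω +
    {ω | τi.1 ω = τj.1 ω}.indicator (D.simPath i τi) ω := by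
  ext ω
  rcases lt_trichotomy (τi.1 ω) (τj.1 ω) with h | h | h
  · simp [outcomePath, Set.indicator, h, h.not_gt, h.ne]
  · simp [outcomePath, Set.indicator, h]
  · simp [outcomePath, Set.indicator, h, h.not_gt, h.ne']

theorem integrable_outcomePath (τi τj : StopTime 𝓕) : Integrable (D.outcomePath i τi τj) P := by
  rw [outcomePath_eq_indicator]
  exact (((D.integrable_leadPath i τi _).indicator
      (τi.past_le _ (τi.measurableSet_lt_left τj))).add
    ((D.integrable_followPath i τj _).indicator (τj.past_le _ (τj.measurableSet_lt_left τi)))).add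
    ((D.integrable_simPath i τi).indicator (τi.past_le _ (τi.measurableSet_eq τj)))

theorem setIntegral_outcomePath (τi τj : StopTime 𝓕) (C : Set Ω) : ∫ ω in C, D.outcomePath i τi τj ω ∂P =
    ∫ ω in C ∩ {ω | τi.1 ω < τj.1 ω}, D.leadPath i τi (D.followerTime i.other τi) ω ∂P +
    ∫ ω in C ∩ {ω | τj.1 ω < τi.1 ω}, D.followPath i τj (D.followerTime i τj) ω ∂P +
    ∫ ω in C ∩ {ω | τi.1 ω = τj.1 ω}, D.simPath i τi ω ∂P := by
  rw [outcomePath_eq_indicator]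
  exact setIntegral_add_indicator (τi.past_le _ (τi.measurableSet_lt_left τj))
    (τj.past_le _ (τj.measurableSet_lt_left τi))
    (τi.past_le _ (τi.measurableSet_eq τj)) (D.integrable_leadPath i τi _)
    (D.integrable_followPath i τj _) (D.integrable_simPath i τi)

variable [IsProbabilityMeasure P]

theorem accrued_add_accruedFrom {X Y : ℝ≥0 → Ω → ℝ} (hX : ProdIntegrable P X)
    (hY : ProdIntegrable P Y) {τ κ : StopTime 𝓕} (h : ALE P τ κ) :
    (fun ω => accrued X τ.1 κ.1 ω + accruedFrom Y κ.1 ω) =ᵐ[P]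
      fun ω => cum X (κ.1 ω) ω - cum X (τ.1 ω) ω + (cum Y ⊤ ω - cum Y (κ.1 ω) ω) := by
  filter_upwards [hX.ae_integrable, hY.ae_integrable, h] with ω h1 h2 h3
  rw [accrued_eq h1 h3, accruedFrom_eq h2]

theorem leader_ae_eq (h𝓕 : UsualConditions P 𝓕) : D.leader i τ =ᵐ[P] fun ω =>
    cum (D.π0 i) (τ.1 ω) ω + (P[fun ω => cum (D.πL i) ((D.followerTime i.other τ).1 ω) ω -
      cum (D.πL i) (τ.1 ω) ω + (cum (D.πB i) ⊤ ω -
        cum (D.πB i) ((D.followerTime i.other τ).1 ω) ω)|τ.past]) ω := by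
  filter_upwards [condExp_congr_ae (m := τ.past) (accrued_add_accruedFrom (D.prodIntegrable_πL i)
    (D.prodIntegrable_πB i) (D.ale_followerTime h𝓕 i.other τ))] with ω hω
  rw [leader, hω]
  rfl

theorem follower_ae_eq (h𝓕 : UsualConditions P 𝓕) : D.follower i τ =ᵐ[P] fun ω =>
    cum (D.π0 i) (τ.1 ω) ω + (P[fun ω => cum (D.πF i) ((D.followerTime i τ).1 ω) ω -
      cum (D.πF i) (τ.1 ω) ω + (cum (D.πB i) ⊤ ω -
        cum (D.πB i) ((D.followerTime i τ).1 ω) ω)|τ.past]) ω := by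
  have hat := D.attains_followerTime h𝓕 i τ
  have hmeas : AEMeasurable (D.followValue i τ (D.followerTime i τ)) P :=
    (integrable_condExp (m := τ.past)).aestronglyMeasurable.aemeasurable
  filter_upwards [condExp_congr_ae (m := τ.past) (accrued_add_accruedFrom (D.prodIntegrable_πF i)
    (D.prodIntegrable_πB i) (D.ale_followerTime h𝓕 i τ)),
    familyEssSup_ae_eq_of_mem
      (S := {f | ∃ τ' : StopTime 𝓕, ALE P τ τ' ∧ f = D.followValue i τ τ'})
      ⟨_, hat.1, rfl⟩ hmeas (by rintro _ ⟨ρ, hρ, rfl⟩; exact hat.2 ρ hρ)] with ω hω hω'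
  rw [follower, hω', followValue, hω]
  rfl

theorem simultaneous_ae_eq : D.simultaneous i τ =ᵐ[P] fun ω =>
    cum (D.π0 i) (τ.1 ω) ω + (P[fun ω => cum (D.πB i) ⊤ ω - cum (D.πB i) (τ.1 ω) ω|τ.past]) ω := by
  have : accruedFrom (D.πB i) τ.1 =ᵐ[P] fun ω => cum (D.πB i) ⊤ ω - cum (D.πB i) (τ.1 ω) ω := by
    filter_upwards [(D.prodIntegrable_πB i).ae_integrable] with ω h1 using accruedFrom_eq h1
  filter_upwards [condExp_congr_ae (m := τ.past) this] with ω hω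
  rw [simultaneous, hω]
  rfl

theorem integrable_leader (h𝓕 : UsualConditions P 𝓕) : Integrable (D.leader i τ) P :=
  (((D.prodIntegrable_π0 i).integrable_cum_stopTime τ).add integrable_condExp).congr
    (D.leader_ae_eq i τ h𝓕).symm

theorem integrable_follower (h𝓕 : UsualConditions P 𝓕) : Integrable (D.follower i τ) P :=
  (((D.prodIntegrable_π0 i).integrable_cum_stopTime τ).add integrable_condExp).congr
    (D.follower_ae_eq i τ h𝓕).symm

theorem integrable_simultaneous : Integrable (D.simultaneous i τ) P :=
  (((D.prodIntegrable_π0 i).integrable_cum_stopTime τ).add integrable_condExp).congr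
    (D.simultaneous_ae_eq i τ).symm

variable {C : Set Ω}

theorem setIntegral_leader (h𝓕 : UsualConditions P 𝓕) (hC : MeasurableSet[τ.past] C) :
    ∫ ω in C, D.leader i τ ω ∂P =
      ∫ ω in C, D.leadPath i τ (D.followerTime i.other τ) ω ∂P := by
  rw [integral_congr_ae (ae_restrict_of_ae (D.leader_ae_eq i τ h𝓕))]
  exact setIntegral_add_condExp τ.past_le ((D.prodIntegrable_π0 i).integrable_cum_stopTime τ)
    (integrable_continuation _ _ (D.prodIntegrable_πL i) (D.prodIntegrable_πB i)) hC

theorem setIntegral_follower (h𝓕 : UsualConditions P 𝓕) (hC : MeasurableSet[τ.past] C) :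
    ∫ ω in C, D.follower i τ ω ∂P =
      ∫ ω in C, D.followPath i τ (D.followerTime i τ) ω ∂P := by
  rw [integral_congr_ae (ae_restrict_of_ae (D.follower_ae_eq i τ h𝓕))]
  exact setIntegral_add_condExp τ.past_le ((D.prodIntegrable_π0 i).integrable_cum_stopTime τ)
    (integrable_continuation _ _ (D.prodIntegrable_πF i) (D.prodIntegrable_πB i)) hC

theorem setIntegral_simultaneous (hC : MeasurableSet[τ.past] C) :
    ∫ ω in C, D.simultaneous i τ ω ∂P = ∫ ω in C, D.simPath i τ ω ∂P := by
  rw [integral_congr_ae (ae_restrict_of_ae (D.simultaneous_ae_eq i τ))]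
  exact setIntegral_add_condExp τ.past_le ((D.prodIntegrable_π0 i).integrable_cum_stopTime τ)
    ((D.prodIntegrable_πB i).integrable_cum_top.sub
      ((D.prodIntegrable_πB i).integrable_cum_stopTime τ)) hC

theorem condExp_leader (h𝓕 : UsualConditions P 𝓕) {ϑ τ : StopTime 𝓕} (h : ALE P ϑ τ) :
    P[D.leader i τ|ϑ.past] =ᵐ[P] P[D.leadPath i τ (D.followerTime i.other τ)|ϑ.past] :=
  condExp_eq_condExp_of_forall_setIntegral_eq ϑ.past_le (D.integrable_leader i τ h𝓕)
    (D.integrable_leadPath i τ _) fun C hC =>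
      D.setIntegral_leader i τ h𝓕 (h𝓕.past_mono h C hC)

section
variable {τi τj : StopTime 𝓕}

theorem integrable_outcome (h𝓕 : UsualConditions P 𝓕) :
    Integrable (D.outcome i τi τj) P :=
  (((D.integrable_leader i τi h𝓕).indicator (τi.past_le _ (τi.measurableSet_lt_left τj))).add
    ((D.integrable_follower i τj h𝓕).indicator (τj.past_le _ (τj.measurableSet_lt_left τi)))).add
    ((D.integrable_simultaneous i τi).indicator
      (τi.past_le _ (τi.measurableSet_eq τj)))

/-- `{τi < τj}` and `{τi = τj}` are known at `τi`, and `{τj < τi}` is known at `τj`. Each payoff is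
thus integrated over an event of its own conditioning σ-algebra, where the conditional expectation
can be removed. -/
theorem setIntegral_outcome (h𝓕 : UsualConditions P 𝓕) (hi : MeasurableSet[τi.past] C)
    (hj : MeasurableSet[τj.past] C) :
    ∫ ω in C, D.outcome i τi τj ω ∂P = ∫ ω in C, D.outcomePath i τi τj ω ∂P := by
  have m1 := τi.measurableSet_lt_left τj
  have m2 := τj.measurableSet_lt_left τi
  have m3 := τi.measurableSet_eq τj
  have n1 := τi.past_le _ m1
  have n2 := τj.past_le _ m2
  have n3 := τi.past_le _ m3
  rw [D.setIntegral_outcomePath, ← D.setIntegral_leader i τi h𝓕 (hi.inter m1),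
    ← D.setIntegral_follower i τj h𝓕 (hj.inter m2), ← D.setIntegral_simultaneous i τi (hi.inter m3)]
  exact setIntegral_add_indicator n1 n2 n3 (D.integrable_leader i τi h𝓕)
    (D.integrable_follower i τj h𝓕) (D.integrable_simultaneous i τi)

theorem payoff_ae_eq (h𝓕 : UsualConditions P 𝓕) {ϑ : StopTime 𝓕} (hi : ALE P ϑ τi)
    (hj : ALE P ϑ τj) : D.payoff i ϑ τi τj =ᵐ[P] P[D.outcomePath i τi τj|ϑ.past] :=
  condExp_eq_condExp_of_forall_setIntegral_eq ϑ.past_le (D.integrable_outcome i h𝓕)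
    (D.integrable_outcomePath i _ _) fun C hC =>
      D.setIntegral_outcome i h𝓕 (h𝓕.past_mono hi C hC) (h𝓕.past_mono hj C hC)

end
end Duopoly
end

section
variable {Ω : Type*} {m : MeasurableSpace Ω} {𝓕 : Filtration ℝ≥0 m} {P : Measure Ω}

theorem condExp_eq_on_of_eq_on [IsFiniteMeasure P] {m' : MeasurableSpace Ω} {f g : Ω → ℝ}
    (hf : Integrable f P) (hg : Integrable g P) {C : Set Ω} (hC : MeasurableSet[m'] C)
    (h : ∀ᵐ ω ∂P, ω ∈ C → f ω = g ω) :
    ∀ᵐ ω ∂P, ω ∈ C → (P[f|m']) ω = (P[g|m']) ω := by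
  have h0 : C.indicator f =ᵐ[P] C.indicator g := by
    filter_upwards [h] with ω hω
    by_cases h1 : ω ∈ C
    · simp [h1, hω h1]
    · simp [h1]
  filter_upwards [condExp_indicator hf hC, condExp_indicator hg hC, condExp_congr_ae (m := m') h0]
    with ω h1 h2 h3 h4
  rw [h3, h2, Set.indicator_of_mem h4, Set.indicator_of_mem h4] at h1
  exact h1.symm

/-! ### Best replies of the two firms. -/

namespace Duopoly

variable (D : Duopoly P 𝓕)

/-- The revenue `π^0 - π^L` that a monopolist gains by postponing investment. -/
def delayGain (i : Firm) : ℝ≥0 → Ω → ℝ := fun s ω => D.π0 i s ω - D.πL i s ω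

theorem prodIntegrable_delayGain (i : Firm) : ProdIntegrable P (D.delayGain i) :=
  (D.prodIntegrable_π0 i).sub (D.prodIntegrable_πL i)

variable [IsProbabilityMeasure P]

theorem cum_delayGain (i : Firm) :
    ∀ᵐ ω ∂P, ∀ t, cum (D.delayGain i) t ω = cum (D.π0 i) t ω - cum (D.πL i) t ω := by
  filter_upwards [(D.prodIntegrable_π0 i).ae_integrable, (D.prodIntegrable_πL i).ae_integrable]
    with ω h1 h2 t using cum_sub h1 h2

theorem monopolyPayoff_ae_eq (i : Firm) (τ : StopTime 𝓕) :
    (fun ω => accruedUntil (D.π0 i) τ.1 ω + accruedFrom (D.πL i) τ.1 ω) =ᵐ[P]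
      fun ω => cum (D.delayGain i) (τ.1 ω) ω + cum (D.πL i) ⊤ ω := by
  filter_upwards [(D.prodIntegrable_πL i).ae_integrable, D.cum_delayGain i] with ω h1 h2
  rw [accruedUntil_apply, accruedFrom_eq h1, h2]
  ring

theorem monopolyValue_ae_eq (i : Firm) (ϑ τ : StopTime 𝓕) : D.monopolyValue i ϑ τ =ᵐ[P]
    P[fun ω => cum (D.delayGain i) (τ.1 ω) ω + cum (D.πL i) ⊤ ω|ϑ.past] :=
  condExp_congr_ae (D.monopolyPayoff_ae_eq i τ)

theorem leadPath_ae_eq (i : Firm) (τ κ : StopTime 𝓕) :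
    D.leadPath i τ κ =ᵐ[P] fun ω => cum (D.delayGain i) (τ.1 ω) ω +
      (cum (D.πL i) (κ.1 ω) ω + (cum (D.πB i) ⊤ ω - cum (D.πB i) (κ.1 ω) ω)) := by
  filter_upwards [D.cum_delayGain i] with ω h
  rw [leadPath, h]
  ring

/-- Time consistency freezes the reaction at its value for `ϑ`, so that `τ` then enters only through
the delay gain (`leadPath_ae_eq`). -/
theorem condExp_leader_of_le (h𝓕 : UsualConditions P 𝓕) (i : Firm) {ϑ τ : StopTime 𝓕}
    (h : ALE P ϑ τ) (h' : ALE P τ (D.followerTime i.other ϑ)) : P[D.leader i τ|ϑ.past] =ᵐ[P]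
      P[D.leadPath i τ (D.followerTime i.other ϑ)|ϑ.past] := by
  refine (D.condExp_leader i h𝓕 h).trans (condExp_congr_ae ?_)
  filter_upwards [D.followerTime_consistent h𝓕 i.other h, h'] with ω h1 h2
  rw [leadPath, leadPath, h1 h2]

/-- Once `T` is reached both firms invest immediately, so following at `T`, investing jointly at `T`
and leading at `T` give firm 1 the same realized payoff. -/
theorem outcomePath_one_ae_eq (h𝓕 : UsualConditions P 𝓕) {ϑ τ : StopTime 𝓕} (h : ALE P ϑ τ) :
    D.outcomePath .one τ (D.followerTime .two ϑ) =ᵐ[P]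
      D.leadPath .one (τ.min (D.followerTime .two ϑ)) (D.followerTime .two ϑ) := by
  set T := D.followerTime .two ϑ with hT
  have hTT := D.followerTime_consistent h𝓕 .two (D.ale_followerTime h𝓕 .two ϑ)
  filter_upwards [D.followerTime_consistent h𝓕 .two h, hTT, D.followerTime_one_le_two h𝓕 T,
    D.ale_followerTime h𝓕 .one T] with ω h1 h2 h3 h4
  replace h2 := h2 le_rfl
  -- Firm 2's reaction to `T` is `T` itself, and firm 1 reacts no later than firm 2.
  have h5 : (D.followerTime .one T).1 ω = T.1 ω := le_antisymm (h3.trans h2.le) h4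
  rcases lt_trichotomy (τ.1 ω) (T.1 ω) with hlt | heq | hgt
  · rw [outcomePath, if_pos hlt, leadPath, leadPath, StopTime.min_apply, min_eq_left hlt.le]
    simp only [Firm.other]
    rw [h1 hlt.le]
  · rw [outcomePath, if_neg heq.not_lt, if_neg heq.not_gt, simPath, leadPath, StopTime.min_apply,
      min_eq_left heq.le, heq]
    ring
  · rw [outcomePath, if_neg hgt.not_gt, if_pos hgt, followPath, leadPath, StopTime.min_apply,
      min_eq_right hgt.le, h5]
    ring

theorem isBestReply_one (h𝓕 : UsualConditions P 𝓕) {ϑ τS : StopTime 𝓕}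
    (hS : D.SolvesLeaderProblem ϑ τS) :
    D.IsBestReply .one ϑ τS (D.followerTime .two ϑ) := by
  have hT := D.ale_followerTime h𝓕 .two ϑ
  have key : ∀ τ, ALE P ϑ τ → D.payoff .one ϑ τ (D.followerTime .two ϑ) =ᵐ[P]
      P[D.leader .one (τ.min (D.followerTime .two ϑ))|ϑ.past] := fun τ hτ =>
    ((D.payoff_ae_eq .one h𝓕 hτ hT).trans
      (condExp_congr_ae (D.outcomePath_one_ae_eq h𝓕 hτ))).trans
      (D.condExp_leader_of_le h𝓕 .one (hτ.min hT) (ale_min_right _ _)).symm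
  -- `τS ∧ T = τS` holds only a.s., so the leader payoffs are compared through their realized
  -- versions with common reaction `T`.
  have hSmin : P[D.leader .one (τS.min (D.followerTime .two ϑ))|ϑ.past] =ᵐ[P]
      P[D.leader .one τS|ϑ.past] := by
    refine (D.condExp_leader_of_le h𝓕 .one (hS.1.1.min hT) (ale_min_right _ _)).trans
      (EventuallyEq.trans (condExp_congr_ae ?_)
        (D.condExp_leader_of_le h𝓕 .one hS.1.1 hS.1.2).symm)
    filter_upwards [hS.1.2] with ω hω
    rw [leadPath, leadPath, StopTime.min_apply, min_eq_left hω]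
  refine ⟨hS.1.1, fun τ hτ => ?_⟩
  exact (key τ hτ).trans_le (((hS.2 _ ⟨ALE.min hτ hT, ale_min_right _ _⟩).trans_eq
    (hSmin.symm.trans (key τS hS.1.1).symm)))

section
variable {ϑ τS : StopTime 𝓕}

theorem outcomePath_two_ae_eq (h𝓕 : UsualConditions P 𝓕) (h : ALE P ϑ τS)
    (h' : ALE P τS (D.followerTime .two ϑ)) :
    D.outcomePath .two (D.followerTime .two ϑ) τS =ᵐ[P]
      D.followPath .two τS (D.followerTime .two ϑ) := by
  filter_upwards [D.followerTime_consistent h𝓕 .two h, h'] with ω h1 h2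
  rcases h2.lt_or_eq with hlt | heq
  · rw [outcomePath, if_neg hlt.not_gt, if_pos hlt, followPath, followPath, h1 h2]
  · rw [outcomePath, if_neg heq.not_gt, if_neg heq.not_lt, followPath, simPath, ← heq]
    ring

/-- Investing at the moment of the opponent's investment is no better than reacting optimally. -/
theorem setIntegral_simPath_le (h𝓕 : UsualConditions P 𝓕) (i : Firm) (τ : StopTime 𝓕) {C : Set Ω}
    (hC : MeasurableSet[τ.past] C) :
    ∫ ω in C, D.simPath i τ ω ∂P ≤ ∫ ω in C, D.followPath i τ (D.followerTime i τ) ω ∂P := by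
  have hX := D.prodIntegrable_waitGain i
  have h1 := setIntegral_cum_le_of_attains hX
    ((D.prodIntegrable_πB i).integrable_cum_top.sub
      ((D.prodIntegrable_πF i).integrable_cum_stopTime τ))
    (fun _ h => D.followValue_ae_eq i h) (D.attains_followerTime h𝓕 i τ) (ALE.refl τ) hC
  have h2 : ∫ ω in C, (D.simPath i τ ω - cum (D.waitGain i) (τ.1 ω) ω) ∂P =
      ∫ ω in C, (D.followPath i τ (D.followerTime i τ) ω -
        cum (D.waitGain i) ((D.followerTime i τ).1 ω) ω) ∂P := by
    refine integral_congr_ae (ae_restrict_of_ae ?_)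
    filter_upwards [D.cum_waitGain i] with ω hω
    simp only [hω, simPath, followPath]
    ring
  rw [integral_sub (D.integrable_simPath i τ).integrableOn
      (hX.integrable_cum_stopTime τ).integrableOn,
    integral_sub (D.integrable_followPath i τ _).integrableOn
      (hX.integrable_cum_stopTime _).integrableOn] at h2
  linarith

/-- Joint investment at `τ` is bounded by following from `τ`, with reaction still `followerTime i
ϑ`; postponing the opponent's investment to `τS` then helps because `π^0 ≥ π^F`. -/
theorem setIntegral_simPath_le_followPath (h𝓕 : UsualConditions P 𝓕) (i : Firm) {τ : StopTime 𝓕}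
    (hϑ : ALE P ϑ τ) (hS : ALE P τS (D.followerTime i ϑ)) {C : Set Ω}
    (hC : MeasurableSet[τ.past] C) (hle : ∀ᵐ ω ∂P, ω ∈ C → τ.1 ω ≤ τS.1 ω) :
    ∫ ω in C, D.simPath i τ ω ∂P ≤ ∫ ω in C, D.followPath i τS (D.followerTime i ϑ) ω ∂P := by
  refine (D.setIntegral_simPath_le h𝓕 i τ hC).trans ?_
  refine setIntegral_mono_on_ae (D.integrable_followPath i τ _).integrableOn
    (D.integrable_followPath i τS _).integrableOn (τ.past_le _ hC) ?_
  filter_upwards [D.followerTime_consistent h𝓕 i hϑ, hS, hle,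
    cum_sub_cum_le (D.prodIntegrable_πF i) (D.prodIntegrable_π0 i) (D.πF_le_π0 i)]
    with ω h1 h2 h3 h4 hω
  replace h3 := h3 hω
  have := h4 _ _ h3
  rw [followPath, followPath, h1 (h3.trans h2)]
  linarith

/-- Under the no-deviation condition, firm 2 does not gain by preempting firm 1. -/
theorem setIntegral_leadPath_two_le (h𝓕 : UsualConditions P 𝓕) (hϑS : ALE P ϑ τS)
    (hST : ALE P τS (D.followerTime .two ϑ)) (hND : D.NoDeviation .two ϑ τS) {τ : StopTime 𝓕}
    (hτ : ALE P ϑ τ) {C : Set Ω} (hC : MeasurableSet[τ.past] C)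
    (hlt : ∀ ω ∈ C, τ.1 ω < τS.1 ω) :
    ∫ ω in C, D.leadPath .two τ (D.followerTime .one τ) ω ∂P ≤
      ∫ ω in C, D.followPath .two τS (D.followerTime .two ϑ) ω ∂P := by
  obtain ⟨δ, hδ, hdev⟩ := hND τ hτ
  set K := D.followerTime .one τ with hK
  set T := D.followerTime .two ϑ with hT
  have hτδ : ALE P τ δ := hδ.1.1
  have hϑδ : ALE P ϑ δ := hτ.trans hτδ
  have hδS : ∀ᵐ ω ∂P, ω ∈ C → δ.1 ω ≤ τS.1 ω := by
    filter_upwards [hδ.1.2] with ω h1 h2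
    rwa [StopTime.max_apply, max_eq_left (hlt ω h2).le] at h1
  have hCm := τ.past_le _ hC
  have hCδ := h𝓕.past_mono hτδ _ hC
  -- On `A` firm 1 would have reacted to `τ` by time `δ`. This event is known at `δ` but perhaps not
  -- at `τ`, so `step1` holds only on all of `C` and the two cases are combined at the end.
  set A : Set Ω := {ω | K.1 ω ≤ δ.1 ω} with hA
  have hAδ : MeasurableSet[δ.past] A := K.2.measurableSet_stopping_time_le δ.2
  have hAm := δ.past_le _ hAδ
  have hX := D.prodIntegrable_delayGain .two
  have step1 : ∫ ω in C, cum (D.delayGain .two) (τ.1 ω) ω ∂P ≤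
      ∫ ω in C, cum (D.delayGain .two) (δ.1 ω) ω ∂P :=
    setIntegral_cum_le_of_attains hX (D.prodIntegrable_πL .two).integrable_cum_top
      (fun ρ _ => D.monopolyValue_ae_eq .two τ ρ) hδ ⟨ALE.refl τ, ale_max_right _ _⟩ hC
  have iX := hX.integrable_cum_stopTime (𝓕 := 𝓕)
  have iL := D.integrable_leadPath .two (P := P)
  have iF := D.integrable_followPath .two (P := P)
  have iS := D.integrable_simPath .two (P := P)
  have split : ∀ {f : Ω → ℝ}, Integrable f P →
      ∫ ω in C, f ω ∂P = ∫ ω in C ∩ A, f ω ∂P + ∫ ω in C ∩ Aᶜ, f ω ∂P := by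
    intro f hf
    rw [← Set.sdiff_eq, integral_inter_add_sdiff hAm hf.integrableOn]
  -- Without the delay gain, the two sides differ by `π^L - π^B` accrued between `K` and `δ`.
  have step2A : ∫ ω in C ∩ A, (D.leadPath .two τ K ω - cum (D.delayGain .two) (τ.1 ω) ω) ∂P ≤
      ∫ ω in C ∩ A, (D.simPath .two δ ω - cum (D.delayGain .two) (δ.1 ω) ω) ∂P := by
    refine setIntegral_mono_on_ae ((iL τ K).sub (iX τ)).integrableOn
      ((iS δ).sub (iX δ)).integrableOn (hCm.inter hAm) ?_
    filter_upwards [D.cum_delayGain .two, cum_sub_cum_le (D.prodIntegrable_πB .two)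
      (D.prodIntegrable_πL .two) (D.πB_le_πL .two)] with ω h1 h2 hω
    have := h2 _ _ (show K.1 ω ≤ δ.1 ω from hω.2)
    simp only [h1, leadPath, simPath]
    linarith
  -- Here `δ` precedes the reaction `K`, so the reaction to `δ` is `K` as well.
  have step2B : ∫ ω in C ∩ Aᶜ, (D.leadPath .two τ K ω - cum (D.delayGain .two) (τ.1 ω) ω) ∂P =
      ∫ ω in C ∩ Aᶜ, (D.leadPath .two δ (D.followerTime .one δ) ω -
        cum (D.delayGain .two) (δ.1 ω) ω) ∂P := by
    refine setIntegral_congr_ae (hCm.inter hAm.compl) ?_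
    filter_upwards [D.cum_delayGain .two, D.followerTime_consistent h𝓕 .one hτδ] with ω h1 h2 hω
    have h3 : δ.1 ω ≤ K.1 ω := (lt_of_not_ge (show ¬K.1 ω ≤ δ.1 ω from hω.2)).le
    simp only [h1, leadPath, h2 h3, ← hK]
    ring
  have step3 : ∫ ω in C ∩ A, D.simPath .two δ ω ∂P ≤ ∫ ω in C ∩ A, D.followPath .two τS T ω ∂P := by
    refine D.setIntegral_simPath_le_followPath h𝓕 .two hϑδ hST (hCδ.inter hAδ) ?_
    filter_upwards [hδS] with ω h1 h2 using h1 h2.1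
  have hB : MeasurableSet[δ.past] (C ∩ Aᶜ) := hCδ.inter hAδ.compl
  have step4 : ∫ ω in C ∩ Aᶜ, D.leadPath .two δ (D.followerTime .one δ) ω ∂P ≤
      ∫ ω in C ∩ Aᶜ, D.followPath .two τS T ω ∂P := by
    -- Intersecting with `{δ ≤ τS}` makes the event known at `τS`, as `setIntegral_follower`
    -- requires; on `C` this removes only a null set.
    have hB' : MeasurableSet[τS.past] ((C ∩ Aᶜ) ∩ {ω | δ.1 ω ≤ τS.1 ω}) :=
      ((δ.2.measurableSet_min_iff τS.2 _).1 (δ.2.measurableSet_inter_le τS.2 _ hB)).2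
    have hBB : ((C ∩ Aᶜ) ∩ {ω | δ.1 ω ≤ τS.1 ω} : Set Ω) =ᵐ[P] (C ∩ Aᶜ : Set Ω) := by
      filter_upwards [hδS] with ω h1
      exact propext ⟨fun h => h.1, fun h => ⟨h, h1 h.1⟩⟩
    calc ∫ ω in C ∩ Aᶜ, D.leadPath .two δ (D.followerTime .one δ) ω ∂P
        = ∫ ω in C ∩ Aᶜ, D.leader .two δ ω ∂P := (D.setIntegral_leader .two δ h𝓕 hB).symm
      _ ≤ ∫ ω in C ∩ Aᶜ, (P[D.follower .two τS|δ.past]) ω ∂P := by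
          refine setIntegral_mono_on_ae (D.integrable_leader .two δ h𝓕).integrableOn
            integrable_condExp.integrableOn (δ.past_le _ hB) ?_
          filter_upwards [hdev] with ω h1 h2
          -- Off `A` the first alternative of the no-deviation condition fails.
          exact (h1 (hlt ω h2.1)).resolve_left h2.2
      _ = ∫ ω in C ∩ Aᶜ, D.follower .two τS ω ∂P :=
          setIntegral_condExp δ.past_le (D.integrable_follower .two τS h𝓕) hB
      _ = ∫ ω in (C ∩ Aᶜ) ∩ {ω | δ.1 ω ≤ τS.1 ω}, D.follower .two τS ω ∂P :=
          (setIntegral_congr_set hBB).symm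
      _ = ∫ ω in (C ∩ Aᶜ) ∩ {ω | δ.1 ω ≤ τS.1 ω},
            D.followPath .two τS (D.followerTime .two τS) ω ∂P :=
          D.setIntegral_follower .two τS h𝓕 hB'
      _ = ∫ ω in C ∩ Aᶜ, D.followPath .two τS (D.followerTime .two τS) ω ∂P :=
          setIntegral_congr_set hBB
      _ = ∫ ω in C ∩ Aᶜ, D.followPath .two τS T ω ∂P := by
          refine integral_congr_ae (ae_restrict_of_ae ?_)
          filter_upwards [D.followerTime_consistent h𝓕 .two hϑS, hST] with ω h1 h2
          rw [followPath, followPath, h1 h2]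
  rw [integral_sub (iL τ K).integrableOn (iX τ).integrableOn,
    integral_sub (iS δ).integrableOn (iX δ).integrableOn] at step2A
  rw [integral_sub (iL τ K).integrableOn (iX τ).integrableOn,
    integral_sub (iL δ _).integrableOn (iX δ).integrableOn] at step2B
  rw [split (iX τ), split (iX δ)] at step1
  rw [split (iL τ K), split (iF τS T)]
  linarith

theorem isBestReply_two (h𝓕 : UsualConditions P 𝓕) (hϑS : ALE P ϑ τS)
    (hST : ALE P τS (D.followerTime .two ϑ)) (hND : D.NoDeviation .two ϑ τS) :
    D.IsBestReply .two ϑ (D.followerTime .two ϑ) τS := by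
  have hT := D.ale_followerTime h𝓕 .two ϑ
  refine ⟨hT, fun τ hτ => (D.payoff_ae_eq .two h𝓕 hτ hϑS).trans_le (EventuallyLE.trans_eq ?_
    ((D.payoff_ae_eq .two h𝓕 hT hϑS).trans
      (condExp_congr_ae (D.outcomePath_two_ae_eq h𝓕 hϑS hST))).symm)⟩
  refine condExp_le_condExp_of_forall_setIntegral_le ϑ.past_le (D.integrable_outcomePath .two _ _)
    (D.integrable_followPath .two _ _) fun C hC => ?_
  set T := D.followerTime .two ϑ
  have hCm := ϑ.past_le _ hC
  have m1 := τ.measurableSet_lt_left τS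
  have m2 := τS.measurableSet_lt_left τ
  have m3 := τ.measurableSet_eq τS
  have hsplit : ∫ ω in C, D.followPath .two τS T ω ∂P =
      ∫ ω in C ∩ {ω | τ.1 ω < τS.1 ω}, D.followPath .two τS T ω ∂P +
      ∫ ω in C ∩ {ω | τS.1 ω < τ.1 ω}, D.followPath .two τS T ω ∂P +
      ∫ ω in C ∩ {ω | τ.1 ω = τS.1 ω}, D.followPath .two τS T ω ∂P := by
    have i := D.integrable_followPath .two τS T
    rw [← setIntegral_add_indicator (τ.past_le _ m1) (τS.past_le _ m2) (τ.past_le _ m3) i i i]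
    congr 1
    ext ω
    rcases lt_trichotomy (τ.1 ω) (τS.1 ω) with h | h | h
    · simp [Set.indicator, h, h.not_gt, h.ne]
    · simp [Set.indicator, h]
    · simp [Set.indicator, h, h.not_gt, h.ne']
  rw [D.setIntegral_outcomePath, hsplit]
  have hCτ := h𝓕.past_mono hτ _ hC
  refine add_le_add (add_le_add ?_ ?_) ?_
  · exact D.setIntegral_leadPath_two_le h𝓕 hϑS hST hND hτ (hCτ.inter m1) fun ω hω => hω.2
  · refine (integral_congr_ae (ae_restrict_of_ae ?_)).le
    filter_upwards [D.followerTime_consistent h𝓕 .two hϑS, hST] with ω h1 h2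
    rw [followPath, followPath, h1 h2]
  · exact D.setIntegral_simPath_le_followPath h𝓕 .two hτ hST (hCτ.inter m3)
      (Eventually.of_forall fun ω hω => hω.2.le)

/-! ### The deviation problem under ordered delay gains. -/

/-- A solution of firm 1's leader problem maximizes the expected gain from delay among the times
before firm 2's reaction. -/
theorem SolvesLeaderProblem.meanCum_delayGain_le (h𝓕 : UsualConditions P 𝓕) {D : Duopoly P 𝓕}
    (hS : D.SolvesLeaderProblem ϑ τS) {ρ : StopTime 𝓕} (h : ALE P ϑ ρ)
    (h' : ALE P ρ (D.followerTime .two ϑ)) :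
    meanCum P (D.delayGain .one) ρ ≤ meanCum P (D.delayGain .one) τS := by
  have := setIntegral_cum_le_of_attains (D.prodIntegrable_delayGain .one)
    (((D.prodIntegrable_πL .one).integrable_cum_stopTime (D.followerTime .two ϑ)).add
      ((D.prodIntegrable_πB .one).integrable_cum_top.sub
        ((D.prodIntegrable_πB .one).integrable_cum_stopTime (D.followerTime .two ϑ))))
    (fun κ hκ => (D.condExp_leader_of_le h𝓕 .one hκ.1 hκ.2).trans
      (condExp_congr_ae (D.leadPath_ae_eq .one κ (D.followerTime .two ϑ)))) hS ⟨h, h'⟩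
    MeasurableSet.univ
  simpa only [setIntegral_univ, meanCum] using this

/-- For admissible `τ`, the time `τ ∧ τS` competes in firm 1's leader problem, so modularity shows
that firm 1's delay gain at `τ ∨ τS = τS ∨ ϑ'` is at least that at `τ`. From `τ` to `τS ∨ ϑ'` firm 2
gains at least as much as firm 1. -/
theorem solvesDeviationProblem_max (h𝓕 : UsualConditions P 𝓕) (hS : D.SolvesLeaderProblem ϑ τS)
    (hgain : ∀ᵐ p ∂(P.prod timeMeasure),
      D.πL .two p.2 p.1 - D.π0 .two p.2 p.1 ≤ D.πL .one p.2 p.1 - D.π0 .one p.2 p.1)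
    {ϑ' : StopTime 𝓕} (h : ALE P ϑ ϑ') :
    D.SolvesDeviationProblem .two τS ϑ' (τS.max ϑ') := by
  refine (h𝓕.attains_iff_meanCum (D.prodIntegrable_delayGain .two)
    (D.prodIntegrable_πL .two).integrable_cum_top (fun ρ hρ => hρ.1)
    (pasteStable_Icc ϑ' (τS.max ϑ')) (fun ρ _ => D.monopolyValue_ae_eq .two ϑ' ρ)).2
    ⟨⟨ale_max_right _ _, ALE.refl _⟩, fun τ hτ => ?_⟩
  have h1 : meanCum P (D.delayGain .one) (τ.min τS) ≤ meanCum P (D.delayGain .one) τS :=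
    hS.meanCum_delayGain_le h𝓕 ((h.trans hτ.1).min hS.1.1) ((ale_min_right _ _).trans hS.1.2)
  have h2 := (D.prodIntegrable_delayGain .one).isModular_meanCum.modular τ τS
  have h3 : meanCum P (D.delayGain .one) (τ.max τS) =
      meanCum P (D.delayGain .one) (τS.max ϑ') := by
    refine integral_congr_ae ?_
    filter_upwards [hτ.1, hτ.2] with ω h4 h5
    have : (τ.max τS).1 ω = (τS.max ϑ').1 ω :=
      le_antisymm (max_le h5 (le_max_left _ _)) (max_le (le_max_right _ _)
        (h4.trans (le_max_left _ _)))
    simp only [this]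
  have h6 : meanCum P (D.delayGain .one) (τS.max ϑ') - meanCum P (D.delayGain .one) τ ≤
      meanCum P (D.delayGain .two) (τS.max ϑ') - meanCum P (D.delayGain .two) τ := by
    have i1 := (D.prodIntegrable_delayGain .one).integrable_cum_stopTime (τS.max ϑ')
    have i2 := (D.prodIntegrable_delayGain .one).integrable_cum_stopTime τ
    have i3 := (D.prodIntegrable_delayGain .two).integrable_cum_stopTime (τS.max ϑ')
    have i4 := (D.prodIntegrable_delayGain .two).integrable_cum_stopTime τ
    simp only [meanCum]
    rw [← integral_sub i1 i2, ← integral_sub i3 i4]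
    refine integral_mono_ae (i1.sub i2) (i3.sub i4) ?_
    have := cum_sub_cum_le (D.prodIntegrable_delayGain .one) (D.prodIntegrable_delayGain .two) (by
      filter_upwards [hgain] with p hp
      simp only [delayGain]
      linarith)
    filter_upwards [this, hτ.2] with ω hω h7 using hω _ _ h7
  linarith

/-- `τS` itself need not be admissible where `τS < ϑ'`. Locality of conditional expectation on `{ϑ'
≤ τ}`, an event known at `ϑ'`, transfers optimality from `τS ∨ ϑ'` to `τS`. -/
theorem monopolyValue_max_eq_on (i : Firm) (τ ϑ' : StopTime 𝓕) : ∀ᵐ ω ∂P, ϑ'.1 ω ≤ τ.1 ω →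
    D.monopolyValue i ϑ' (τ.max ϑ') ω = D.monopolyValue i ϑ' τ ω := by
  have hi : ∀ ρ : StopTime 𝓕, Integrable
      (fun ω => cum (D.delayGain i) (ρ.1 ω) ω + cum (D.πL i) ⊤ ω) P := fun ρ =>
    ((D.prodIntegrable_delayGain i).integrable_cum_stopTime ρ).add
      (D.prodIntegrable_πL i).integrable_cum_top
  filter_upwards [D.monopolyValue_ae_eq i ϑ' τ, D.monopolyValue_ae_eq i ϑ' (τ.max ϑ'),
    condExp_eq_on_of_eq_on (C := {ω | ϑ'.1 ω ≤ τ.1 ω}) (hi (τ.max ϑ')) (hi τ)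
      (ϑ'.2.measurableSet_le_stopping_time τ.2) (Eventually.of_forall fun ω hω => by
        rw [StopTime.max_apply, max_eq_left hω])] with ω h1 h2 h3 h4
  rw [h1, h2, h3 h4]

end
end Duopoly
end
end
end InvestmentTiming

theorem corollary1 {Ω : Type*} {m : MeasurableSpace Ω} (P : Measure Ω) [IsProbabilityMeasure P]
    (𝓕 : Filtration ℝ≥0 m) (h𝓕 : InvestmentTiming.UsualConditions P 𝓕)
    (D : InvestmentTiming.Duopoly P 𝓕) (ϑ τS : InvestmentTiming.StopTime 𝓕)
    (hS : D.SolvesLeaderProblem ϑ τS) :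
    (D.NoDeviation .two ϑ τS → D.IsEquilibrium ϑ τS (D.followerTime .two ϑ)) ∧
    ((∀ᵐ p ∂(P.prod InvestmentTiming.timeMeasure),
        D.πL .two p.2 p.1 - D.π0 .two p.2 p.1 ≤ D.πL .one p.2 p.1 - D.π0 .one p.2 p.1) →
      ∀ ϑ' : InvestmentTiming.StopTime 𝓕, InvestmentTiming.ALE P ϑ ϑ' →
        D.SolvesDeviationProblem .two τS ϑ' (τS.max ϑ') ∧
        ∀ τ ∈ InvestmentTiming.Duopoly.deviationTimes P τS ϑ', ∀ᵐ ω ∂P, ϑ'.1 ω ≤ τS.1 ω →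
          D.monopolyValue .two ϑ' τ ω ≤ D.monopolyValue .two ϑ' τS ω) := by
  refine ⟨fun hND => ⟨D.isBestReply_one h𝓕 hS, D.isBestReply_two h𝓕 hS.1.1 hS.1.2 hND⟩,
    fun hgain ϑ' h => ?_⟩
  have hmax := D.solvesDeviationProblem_max h𝓕 hS hgain h
  refine ⟨hmax, fun τ hτ => ?_⟩
  filter_upwards [hmax.2 τ hτ, D.monopolyValue_max_eq_on .two τS ϑ'] with ω h1 h2 h3
  exact h1.trans_eq (h2 h3)
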